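/- Let $F$ be a totally real number field of degree $n=[F:\mathbb{Q}]$, let $S_\infty$ be its set of infinite places, let $S\supset S_\infty$ and $T$ be disjoint finite sets of places of $F$, $S_f=S\setminus S_\infty$, and let $V\subsetneq S$. Assume: $V\not\supset S_\infty$; no prime of $S$ has the same residue characteristic as a prime of $T$; no two distinct primes of $T$ have the same residue characteristic; and $T$ contains at least two primes of degree one, or at least one prime $\eta$ of degree one with $N\eta\ge n+2$ (a prime is of degree one if its norm is a rational prime). Let $T'$ be the set of primes with the same residue characteristic as some prime of $T$, $\mathsf I_F$ the group of fractional ideals of $F$, $\mathsf I_{(T)}\subset \mathsf I_F$ and $F_{(T)}\subset F^\times$ the subgroups of fractional ideals, respectively elements, coprime to $T'$, $E=\mathcal O_F^\times\subset F_{(T)}$, and $\mathrm{sgn}(x)\in\{\pm1\}$ the product of the signs of $x\in F^\times$ at all infinite places. Let $N^S=\prod'_{v\notin S}F_v^\times/O_v^\times$ (almost all components trivial) and let $i^S:F^\times\to N^S$ be the diagonal map. For $W\subset S_\infty$ put $X_W=\prod_{v\in W}F_v^\times/\mathbb{R}_+$, and for $g\in X_W$ let $F_g$ be the set of $x\in F_{(T)}$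 with image $g$ in $X_W$. Let $C_k(X)$ be the free abelian group on the $k$-tuples of elements of $X$, with $d_k(x_1,\dots,x_k)=\sum_{i=1}^{k}(-1)^{i-1}(x_1,\dots,\widehat{x_i},\dots,x_k)$. Put $C_{k,W}=\bigoplus_{g\in X_W}C_k(F_g)$, write $\Lambda[[g]]$ for $\Lambda\in C_k(F_g)$ in the summand of $g$, and let $x\in F_{(T)}$ act by $[x](\Lambda[[g]])=\mathrm{sgn}(x)\,(x\Lambda)[[xg]]$. Let $\mathscr K_W=C_{n,W}/\ker(d_n:C_{n,W}\to C_{n-1,W})$. For $W\subset S_f$ let $\mathscr A_W\subset\mathbb{Z}[\mathsf I_F]$ be the $\mathbb{Z}[\mathsf I_{(T)}]$-submodule generated by $\prod_{\mathfrak p\in W}(1-[\mathfrak p])\prod_{\mathfrak p\in T}(1-N(\mathfrak p)[\mathfrak p])$; $F_{(T)}$ acts on it through principal ideals. For $W\subset V$ put $\bar W=W\cup(S\setminus V)$, let $\mathscr M_W=\mathscr K_{\bar W\cap S_\infty}\otimes_{\mathbb Z}\mathscr A_{\bar W\cap S_f}$ with the diagonal action of $F_{(T)}$, and let $$B(W)=\left(\mathscr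 M_W\otimes_{\mathbb Z}\mathbb{Z}[N^S]\otimes_{\mathbb Z}\mathbb{Z}[F^\times]\right)/\mathscr N,$$ where $\mathscr N$ is the $\mathbb{Z}$-span of the elements $x^{-1}a\otimes i^S(x)b\otimes c-a\otimes b\otimes xc$ with $x\in F_{(T)}$, $a\in\mathscr M_W$, $b\in\mathbb{Z}[N^S]$, $c\in\mathbb{Z}[F^\times]$; $F^\times$ acts on $B(W)$ by $x(a\otimes b\otimes c)=a\otimes b\otimes xc$. Then: (1) $H_i(E,\mathscr K_W)=0$ for all non-empty $W\subset S_\infty$ and all $i>0$. (2) $H_i(F^\times,B(W))=0$ for all $W\subset V$ and all $i>0$. -/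

import Mathlib

open NumberField IsDedekindDomain TensorProduct
open scoped nonZeroDivisors RestrictedProduct

noncomputable section

namespace ShintaniDatum

attribute [-instance] AddCommGroup.toIntModule

variable {F : Type} [Field F] [NumberField F]

/-! ### Places, ideals and the condition on `(S, T, V)` -/

/-- The places of `F`: infinite places, and finite places given by the nonzero primes. -/
abbrev Place (F : Type) [Field F] [NumberField F] : Type :=
  InfinitePlace F ⊕ HeightOneSpectrum (𝓞 F)

/-- The residue characteristic of a finite place. -/
def residueChar (p : HeightOneSpectrum (𝓞 F)) : ℕ := ringChar (𝓞 F ⧸ p.asIdeal)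

/-- A prime has degree one if its norm is a rational prime. -/
def IsDegreeOne (p : HeightOneSpectrum (𝓞 F)) : Prop := (Ideal.absNorm p.asIdeal).Prime

/-- The condition on `(S, T, V)`; `S.toRight` and `T.toRight` are the sets of finite places
(that is, of primes) in `S` and in `T`. -/
structure ConditionC1 (S T V : Finset (Place F)) : Prop where
  exists_infinite_notMem : ∃ v : InfinitePlace F, Sum.inl v ∉ V
  residueChar_ne : ∀ p ∈ S.toRight, ∀ q ∈ T.toRight, residueChar p ≠ residueChar q
  residueChar_inj : ∀ p ∈ T.toRight, ∀ q ∈ T.toRight, p ≠ q → residueChar p ≠ residueChar q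
  degree_one :
    (∃ p ∈ T.toRight, ∃ q ∈ T.toRight, p ≠ q ∧ IsDegreeOne p ∧ IsDegreeOne q) ∨
    (∃ p ∈ T.toRight, IsDegreeOne p ∧ Module.finrank ℚ F + 2 ≤ Ideal.absNorm p.asIdeal)

/-- `T'`: the primes with the same residue characteristic as some prime in `T`. -/
def primesAbove (T : Finset (Place F)) : Set (HeightOneSpectrum (𝓞 F)) :=
  {p | ∃ q ∈ T.toRight, residueChar p = residueChar q}

/-- The group of (nonzero) fractional ideals of `F`. -/
abbrev IdealGroup (F : Type) [Field F] [NumberField F] : Type := (FractionalIdeal (𝓞 F)⁰ F)ˣ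

/-- A prime, as an element of the group of fractional ideals. -/
def primeIdeal (p : HeightOneSpectrum (𝓞 F)) : IdealGroup F :=
  FractionalIdeal.mk0 F ⟨p.asIdeal, mem_nonZeroDivisors_of_ne_zero p.ne_bot⟩

/-- The group of fractional ideals coprime to `T'`. -/
def idealsPrimeTo (T : Finset (Place F)) : Subgroup (IdealGroup F) where
  carrier := {I | ∀ p ∈ primesAbove T, FractionalIdeal.count F p (I : FractionalIdeal (𝓞 F)⁰ F) = 0}
  one_mem' p _ := by
    rw [Units.val_one]; exact FractionalIdeal.count_one F p
  mul_mem' {I J} hI hJ p hp := by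
    rw [Units.val_mul, FractionalIdeal.count_mul F p I.ne_zero J.ne_zero, hI p hp, hJ p hp,
      add_zero]
  inv_mem' {I} hI p hp := by
    rw [Units.val_inv_eq_inv_val, FractionalIdeal.count_inv, hI p hp, neg_zero]

/-- `F_(T)`: the group of elements of `Fˣ` coprime to `T'`. -/
def elementsPrimeTo (T : Finset (Place F)) : Subgroup Fˣ :=
  (idealsPrimeTo T).comap (toPrincipalIdeal (𝓞 F) F)

lemma unit_mem_elementsPrimeTo (T : Finset (Place F)) (u : (𝓞 F)ˣ) :
    Units.map (algebraMap (𝓞 F) F).toMonoidHom u ∈ elementsPrimeTo T := by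
  have h : toPrincipalIdeal (𝓞 F) F (Units.map (algebraMap (𝓞 F) F).toMonoidHom u) = 1 := by
    rw [toPrincipalIdeal_eq_iff, Units.val_one]
    change FractionalIdeal.spanSingleton (𝓞 F)⁰ (algebraMap (𝓞 F) F (u : 𝓞 F)) = 1
    rw [← FractionalIdeal.coeIdeal_span_singleton, Ideal.span_singleton_eq_top.2 u.isUnit,
      FractionalIdeal.coeIdeal_top]
  rw [elementsPrimeTo, Subgroup.mem_comap, h]
  exact one_mem _

/-- The inclusion of the unit group `E = (𝓞 F)ˣ` in `F_(T)`. -/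
def unitsToElements (T : Finset (Place F)) : (𝓞 F)ˣ →* elementsPrimeTo T :=
  (Units.map (algebraMap (𝓞 F) F).toMonoidHom).codRestrict _ (unit_mem_elementsPrimeTo T)

/-! ### Signs -/

section Signs

variable [IsTotallyReal F]

/-- The map `Fˣ → F_vˣ = ℝˣ` at an infinite place `v` of the totally real field `F`. -/
def realUnit (v : InfinitePlace F) : Fˣ →* ℝˣ :=
  Units.map (InfinitePlace.embedding_of_isReal (IsTotallyReal.isReal v)).toMonoidHom

/-- `sgn(x)`: the product over the infinite places of the signs of `x`. -/
def sgn : Fˣ →* ℤ :=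
  ∏ v : InfinitePlace F, ((SignType.castHom (α := ℤ)).toMonoidHom.comp
    ((signHom (α := ℝ)).toMonoidHom.comp ((Units.coeHom ℝ).comp (realUnit v))))

/-- `X_W`: the product over `v ∈ W` of `F_vˣ / ℝ_+`. -/
def SignSpace (W : Finset (InfinitePlace F)) : Type := W → ℝˣ ⧸ Units.posSubgroup ℝ

instance (W : Finset (InfinitePlace F)) : CommGroup (SignSpace W) :=
  inferInstanceAs (CommGroup (W → ℝˣ ⧸ Units.posSubgroup ℝ))

/-- The diagonal map `Fˣ → X_W`. -/
def signDiag (W : Finset (InfinitePlace F)) : Fˣ →* SignSpace W :=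
  MonoidHom.pi fun v => (QuotientGroup.mk' (Units.posSubgroup ℝ)).comp (realUnit (v : InfinitePlace F))

/-! ### The modules `C_{k,W}` and `𝒦_W` -/

/-- `F_g`: the elements of `F_(T)` whose image in `X_W` is `g`. -/
abbrev SignClass (T : Finset (Place F)) (W : Finset (InfinitePlace F)) (g : SignSpace W) : Type :=
  {x : elementsPrimeTo T // signDiag W (x : Fˣ) = g}

/-- The basis of `C_{k,W}`: the symbols `(x₁, …, x_k)⟦g⟧` with `g ∈ X_W` and `x_j ∈ F_g`. -/
abbrev Symbols (T : Finset (Place F)) (W : Finset (InfinitePlace F)) (k : ℕ) : Type :=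
  Σ g : SignSpace W, Fin k → SignClass T W g

/-- `C_{k,W} = ⨁_{g ∈ X_W} C_k(F_g)`, where `C_k(X)` is the free abelian group on `X^k`. -/
abbrev Chains (T : Finset (Place F)) (W : Finset (InfinitePlace F)) (k : ℕ) : Type :=
  Symbols T W k →₀ ℤ

variable (T : Finset (Place F)) (W : Finset (InfinitePlace F))

/-- `(x₁, …, x_k)⟦g⟧ ↦ (x x₁, …, x x_k)⟦x g⟧`. -/
def symbolsMul (k : ℕ) (x : elementsPrimeTo T) (s : Symbols T W k) : Symbols T W k :=
  ⟨signDiag W (x : Fˣ) * s.1, fun j => ⟨x * (s.2 j).1, by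
    rw [Subgroup.coe_mul, map_mul, (s.2 j).2]⟩⟩

lemma symbols_ext {k : ℕ} {s t : Symbols T W k} (h₁ : s.1 = t.1)
    (h₂ : ∀ j, (s.2 j).1 = (t.2 j).1) : s = t := by
  obtain ⟨g, s⟩ := s
  obtain ⟨g', t⟩ := t
  obtain rfl : g = g' := h₁
  congr 1
  funext j
  exact Subtype.ext (h₂ j)

lemma symbolsMul_one (k : ℕ) : symbolsMul T W k 1 = id := by
  funext s
  refine symbols_ext T W ?_ fun j => ?_
  · change signDiag W 1 * s.1 = s.1
    rw [map_one]
    exact one_mul s.1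
  · exact one_mul _

lemma symbolsMul_mul (k : ℕ) (x y : elementsPrimeTo T) :
    symbolsMul T W k (x * y) = symbolsMul T W k x ∘ symbolsMul T W k y := by
  funext s
  refine symbols_ext T W ?_ fun j => mul_assoc _ _ _
  change signDiag W (x * y) * s.1 = signDiag W x * (signDiag W y * s.1)
  rw [map_mul]
  exact mul_assoc (signDiag W (x : Fˣ)) (signDiag W (y : Fˣ)) s.1

/-- The action `[x](Λ⟦g⟧) = sgn(x) (xΛ)⟦xg⟧` of `F_(T)` on `C_{k,W}`. -/
def chainsRep (k : ℕ) : Representation ℤ (elementsPrimeTo T) (Chains T W k) where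
  toFun x := sgn (x : Fˣ) • Finsupp.lmapDomain ℤ ℤ (symbolsMul T W k x)
  map_one' := by
    rw [symbolsMul_one, Finsupp.lmapDomain_id, Subgroup.coe_one, map_one, one_smul]; rfl
  map_mul' x y := by
    rw [symbolsMul_mul, Finsupp.lmapDomain_comp, Subgroup.coe_mul, map_mul, smul_mul_smul_comm]
    rfl

/-- `d_{k+1} : C_{k+1,W} → C_{k,W}`, the alternating sum of the maps omitting one entry. -/
def boundary (k : ℕ) : Chains T W (k + 1) →ₗ[ℤ] Chains T W k :=
  Finsupp.linearCombination ℤ fun s : Symbols T W (k + 1) =>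
    ∑ i : Fin (k + 1), Finsupp.single (⟨s.1, fun j => s.2 (i.succAbove j)⟩ : Symbols T W k)
      ((-1 : ℤ) ^ (i : ℕ))

lemma boundary_chainsRep (k : ℕ) (x : elementsPrimeTo T) :
    boundary T W k ∘ₗ chainsRep T W (k + 1) x = chainsRep T W k x ∘ₗ boundary T W k := by
  apply Finsupp.lhom_ext'
  intro s
  ext1
  simp only [chainsRep, boundary, MonoidHom.coe_mk, OneHom.coe_mk, LinearMap.comp_apply,
    LinearMap.smul_apply, Finsupp.lsingle_apply, Finsupp.lmapDomain_apply,
    Finsupp.mapDomain_single, map_smul, Finsupp.linearCombination_single, one_smul, map_sum, Finset.smul_sum]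
  rfl

lemma ker_boundary_le (k : ℕ) (x : elementsPrimeTo T) :
    LinearMap.ker (boundary T W k) ≤
      (LinearMap.ker (boundary T W k)).comap (chainsRep T W (k + 1) x) := by
  intro c hc
  rw [Submodule.mem_comap, LinearMap.mem_ker, ← LinearMap.comp_apply, boundary_chainsRep,
    LinearMap.comp_apply, LinearMap.mem_ker.1 hc, map_zero]

/-- `𝒦_W = C_{n,W} / ker (d_n : C_{n,W} → C_{n-1,W})` with `n = [F : ℚ]`
(as `n ≥ 1`, the index `(n - 1) + 1` below is `n`). -/
abbrev KMod : Type :=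
  Chains T W (Module.finrank ℚ F - 1 + 1) ⧸ LinearMap.ker (boundary T W (Module.finrank ℚ F - 1))

/-- The action of `F_(T)` on `𝒦_W`. -/
def kRep : Representation ℤ (elementsPrimeTo T) (KMod T W) where
  toFun x := Submodule.mapQ _ _ (chainsRep T W _ x) (ker_boundary_le T W _ x)
  map_one' := by
    apply Submodule.linearMap_qext
    rw [Submodule.mapQ_mkQ, map_one]; rfl
  map_mul' x y := by
    apply Submodule.linearMap_qext
    rw [Submodule.mapQ_mkQ, map_mul]; rfl

/-- `𝒦_W` as a module over the unit group `E`. -/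
def kUnitsRep : Rep ℤ (𝓞 F)ˣ := Rep.of ((kRep T W).comp (unitsToElements T))

end Signs

/-! ### The module `𝒜_W` -/

/-- `∏_{p ∈ W} (1 - [p]) ∏_{p ∈ T} (1 - N(p)[p])` in the group ring of the ideal group. -/
def delta (T : Finset (Place F)) (W : Finset (HeightOneSpectrum (𝓞 F))) :
    MonoidAlgebra ℤ (IdealGroup F) :=
  (∏ p ∈ W, (1 - MonoidAlgebra.single (primeIdeal p) 1)) *
    ∏ p ∈ T.toRight, (1 - MonoidAlgebra.single (primeIdeal p) (Ideal.absNorm p.asIdeal : ℤ))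

/-- `𝒜_W`: the submodule over the group ring of the group of fractional ideals coprime to `T'`
generated by `delta T W`, i.e. the additive group spanned by the products `[𝔞] * delta T W`. -/
def AMod (T : Finset (Place F)) (W : Finset (HeightOneSpectrum (𝓞 F))) :
    Submodule ℤ (MonoidAlgebra ℤ (IdealGroup F)) :=
  Submodule.span ℤ (Set.range fun I : idealsPrimeTo T =>
    MonoidAlgebra.single (I : IdealGroup F) 1 * delta T W)

lemma mul_mem_AMod (T : Finset (Place F)) (W : Finset (HeightOneSpectrum (𝓞 F)))
    (x : elementsPrimeTo T) : ∀ a ∈ AMod T W, LinearMap.mulLeft ℤ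
      (MonoidAlgebra.single (toPrincipalIdeal (𝓞 F) F (x : Fˣ)) (1 : ℤ)) a ∈ AMod T W := by
  intro a ha
  induction ha using Submodule.span_induction with
  | mem a ha =>
    obtain ⟨I, rfl⟩ := ha
    refine Submodule.subset_span ⟨⟨toPrincipalIdeal (𝓞 F) F (x : Fˣ), x.2⟩ * I, ?_⟩
    simp [LinearMap.mulLeft_apply, ← mul_assoc, MonoidAlgebra.single_mul_single]
  | zero => rw [map_zero]; exact zero_mem _
  | add a b _ _ ha hb => rw [map_add]; exact add_mem ha hb
  | smul r a _ ha => rw [map_smul]; exact Submodule.smul_mem _ r ha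

/-- `F_(T)` acts on `𝒜_W` through multiplication by principal ideals. -/
def aRep (T : Finset (Place F)) (W : Finset (HeightOneSpectrum (𝓞 F))) :
    Representation ℤ (elementsPrimeTo T) (AMod T W) where
  toFun x := (LinearMap.mulLeft ℤ (MonoidAlgebra.single
    (toPrincipalIdeal (𝓞 F) F (x : Fˣ)) (1 : ℤ))).restrict (mul_mem_AMod T W x)
  map_one' := by
    ext1 a
    apply Subtype.ext
    rw [LinearMap.coe_restrict_apply, Subgroup.coe_one, map_one, LinearMap.mulLeft_apply,
      ← MonoidAlgebra.one_def, one_mul]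
    rfl
  map_mul' x y := by
    ext1 a
    apply Subtype.ext
    rw [Module.End.mul_apply, LinearMap.coe_restrict_apply, LinearMap.coe_restrict_apply,
      LinearMap.coe_restrict_apply, LinearMap.mulLeft_apply, LinearMap.mulLeft_apply,
      LinearMap.mulLeft_apply, ← mul_assoc, MonoidAlgebra.single_mul_single, mul_one,
      Subgroup.coe_mul, map_mul]

/-! ### The group `N^S` -/

/-- `N_v = F_vˣ / O_vˣ` for a finite place `v`. -/
abbrev LocalQuot (p : HeightOneSpectrum (𝓞 F)) : Type :=
  (p.adicCompletion F)ˣ ⧸ (p.adicCompletionIntegers F).unitGroup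

/-- `N^S`: the restricted product over `v ∉ S` of `N_v = F_vˣ / O_vˣ`
(almost all components are trivial). -/
def NAway (S : Finset (Place F)) : Type :=
  Πʳ p : {p : HeightOneSpectrum (𝓞 F) // Sum.inr p ∉ S},
    [LocalQuot p.1, (⊥ : Subgroup (LocalQuot p.1))]

instance (S : Finset (Place F)) : CommGroup (NAway S) :=
  inferInstanceAs (CommGroup (Πʳ p : {p : HeightOneSpectrum (𝓞 F) // Sum.inr p ∉ S},
    [LocalQuot p.1, (⊥ : Subgroup (LocalQuot p.1))]))

/-- The map `Fˣ → F_vˣ` at a finite place `v`. -/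
def localUnit (p : HeightOneSpectrum (𝓞 F)) : Fˣ →* (p.adicCompletion F)ˣ :=
  Units.map (algebraMap F (p.adicCompletion F)).toMonoidHom

lemma finite_localUnit (x : Fˣ) : {p : HeightOneSpectrum (𝓞 F) |
    localUnit p x ∉ (p.adicCompletionIntegers F).unitGroup}.Finite := by
  refine ((HeightOneSpectrum.Support.finite (𝓞 F) (x : F)).union
    (HeightOneSpectrum.Support.finite (𝓞 F) ((x⁻¹ : Fˣ) : F))).subset ?_
  intro p hp
  by_contra h
  rw [Set.mem_union, not_or] at h
  have hle : ∀ y : Fˣ, p ∉ HeightOneSpectrum.Support (𝓞 F) (y : F) →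
      (p.adicCompletionIntegers F).valuation (localUnit p y : p.adicCompletion F) ≤ 1 := by
    intro y hy
    rw [ValuationSubring.valuation_le_one_iff, HeightOneSpectrum.mem_adicCompletionIntegers]
    change Valued.v ((y : F) : p.adicCompletion F) ≤ 1
    rw [HeightOneSpectrum.valuedAdicCompletion_eq_valuation']
    exact not_lt.1 hy
  apply hp
  rw [ValuationSubring.mem_unitGroup_iff]
  refine le_antisymm (hle x h.1) ?_
  have h2 := hle x⁻¹ h.2
  rw [map_inv, Units.val_inv_eq_inv_val, map_inv₀] at h2
  exact (inv_le_one₀ (zero_lt_iff.2 (by simp))).1 h2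

/-- The map `Fˣ → N_v = F_vˣ / O_vˣ` at a finite place `v`. -/
def localClass (p : HeightOneSpectrum (𝓞 F)) : Fˣ →* LocalQuot p :=
  (QuotientGroup.mk' (p.adicCompletionIntegers F).unitGroup).comp (localUnit p)

lemma eventually_localClass (S : Finset (Place F)) (x : Fˣ) :
    ∀ᶠ p : {p : HeightOneSpectrum (𝓞 F) // Sum.inr p ∉ S} in Filter.cofinite,
      localClass p.1 x ∈ ((⊥ : Subgroup (LocalQuot p.1)) : Set (LocalQuot p.1)) := by
  have h := (finite_localUnit x).preimage
    (Subtype.val_injective (p := fun p : HeightOneSpectrum (𝓞 F) => Sum.inr p ∉ S)).injOn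
  filter_upwards [h.compl_mem_cofinite] with p hp
  have hp' : localUnit p.1 x ∈ (p.1.adicCompletionIntegers F).unitGroup := not_not.1 hp
  exact (QuotientGroup.eq_one_iff _).2 hp'

/-- `i^S : Fˣ → N^S`, the diagonal map. -/
def diagAway (S : Finset (Place F)) : Fˣ →* NAway S where
  toFun x := ⟨fun p => localClass p.1 x, eventually_localClass S x⟩
  map_one' := Subtype.ext <| funext fun p => map_one (localClass p.1)
  map_mul' x y := Subtype.ext <| funext fun p => map_mul (localClass p.1) x y

/-! ### The construction of `B(W)` from `ℳ_W`

Let `H` be a subgroup of an abelian group `G`, let `ι : G → N` be a homomorphism to an abelian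
group, and let `ρ` be an action of `H` on `M`. -/

section TwistedInduction

variable {G N M : Type} [CommGroup G] [CommGroup N] [AddCommGroup M] [Module ℤ M]
  (H : Subgroup G) (ι : G →* N) (ρ : Representation ℤ H M)

/-- The subgroup of `M ⊗ ℤ[N] ⊗ ℤ[G]` spanned by the elements
`x⁻¹a ⊗ ι(x)b ⊗ c - a ⊗ b ⊗ xc` with `x ∈ H`. -/
def relations : Submodule ℤ ((M ⊗[ℤ] MonoidAlgebra ℤ N) ⊗[ℤ] MonoidAlgebra ℤ G) :=
  Submodule.span ℤ {t | ∃ (x : H) (a : M) (b : MonoidAlgebra ℤ N) (c : MonoidAlgebra ℤ G),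
    t = (ρ x⁻¹ a ⊗ₜ[ℤ] (MonoidAlgebra.single (ι (x : G)) (1 : ℤ) * b)) ⊗ₜ[ℤ] c
      - (a ⊗ₜ[ℤ] b) ⊗ₜ[ℤ] (MonoidAlgebra.single (x : G) (1 : ℤ) * c)}

/-- The quotient of `M ⊗ ℤ[N] ⊗ ℤ[G]` by these relations. -/
abbrev TwistedInd : Type :=
  ((M ⊗[ℤ] MonoidAlgebra ℤ N) ⊗[ℤ] MonoidAlgebra ℤ G) ⧸ relations H ι ρ

/-- Multiplication by `y ∈ G` on the last factor: `a ⊗ b ⊗ c ↦ a ⊗ b ⊗ yc`. -/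
def mulLast (y : G) : ((M ⊗[ℤ] MonoidAlgebra ℤ N) ⊗[ℤ] MonoidAlgebra ℤ G) →ₗ[ℤ]
    ((M ⊗[ℤ] MonoidAlgebra ℤ N) ⊗[ℤ] MonoidAlgebra ℤ G) :=
  LinearMap.lTensor _ (LinearMap.mulLeft ℤ (MonoidAlgebra.single y (1 : ℤ)))

lemma relations_le (y : G) : relations H ι ρ ≤ (relations H ι ρ).comap (mulLast y) := by
  refine Submodule.span_le.2 ?_
  rintro _ ⟨x, a, b, c, rfl⟩
  refine Submodule.subset_span ⟨x, a, b, MonoidAlgebra.single y (1 : ℤ) * c, ?_⟩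
  rw [mul_left_comm]
  simp only [mulLast, map_sub, LinearMap.lTensor_tmul, LinearMap.mulLeft_apply]

/-- The action `y(a ⊗ b ⊗ c) = a ⊗ b ⊗ yc` of `G` on the quotient. -/
def twistedIndRep : Representation ℤ G (TwistedInd H ι ρ) where
  toFun y := Submodule.mapQ _ _ (mulLast y) (relations_le H ι ρ y)
  map_one' := by
    apply Submodule.linearMap_qext
    rw [Submodule.mapQ_mkQ, mulLast, ← MonoidAlgebra.one_def, LinearMap.mulLeft_one,
      LinearMap.lTensor_id]
    rfl
  map_mul' x y := by
    apply Submodule.linearMap_qext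
    rw [Submodule.mapQ_mkQ, mulLast, show MonoidAlgebra.single (x * y) (1 : ℤ) =
      MonoidAlgebra.single x 1 * MonoidAlgebra.single y 1 by
        rw [MonoidAlgebra.single_mul_single, mul_one],
      LinearMap.mulLeft_mul, LinearMap.lTensor_comp]
    rfl

end TwistedInduction

/-! ### The modules `ℳ_W` and `B(W)` -/

open Classical in
/-- `W̄ = W ∪ (S \ V)`; its infinite part is `(W̄).toLeft` and its finite part `(W̄).toRight`. -/
def barSet (S V W : Finset (Place F)) : Finset (Place F) := W ∪ (S \ V)

section B

variable [IsTotallyReal F] (S T V W : Finset (Place F))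

/-- `ℳ_W = 𝒦_{W̄ ∩ S_∞} ⊗ 𝒜_{W̄ ∩ S_f}`. -/
abbrev MMod : Type := KMod T (barSet S V W).toLeft ⊗[ℤ] AMod T (barSet S V W).toRight

/-- The diagonal action `x(f ⊗ g) = xf ⊗ xg` of `F_(T)` on `ℳ_W`. -/
def mRep : Representation ℤ (elementsPrimeTo T) (MMod S T V W) :=
  (kRep T (barSet S V W).toLeft).tprod (aRep T (barSet S V W).toRight)

/-- The `ℤ[Fˣ]`-module `B(W)`: the quotient of `ℳ_W ⊗ ℤ[N^S] ⊗ ℤ[Fˣ]` by the span of the elements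
`x⁻¹a ⊗ i^S(x)b ⊗ c - a ⊗ b ⊗ xc` with `x ∈ F_(T)`, where `Fˣ` acts on the last factor. -/
def bRep : Rep ℤ Fˣ :=
  Rep.of (twistedIndRep (elementsPrimeTo T) (diagAway S) (mRep S T V W))

end B

end ShintaniDatum

end

/-!
The complex of tuples `⋯ → C_{2,W} → C_{1,W} → C_{0,W}` is exact in positive degrees, by coning off
with a base point in each non-empty `F_g` (`boundary_cone`, `range_boundary_succ`). A group `D` of
units acts freely on the basis of `C_{k,W}` for `k ≥ 1`, so these modules have no higher homology,
and dimension shifting along the complex (`homologyVanishesAbove_imageRep`) embeds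
`H_i(D, 𝒦_W)`, for `i > 0`, in the homology in degree `i + n - 1`, with `n = [F : ℚ]`, of the image
of `d_1` in `C_{0,W}`. That image is a permutation module, twisted by the sign, on the set of those
`g ∈ X_W` with `F_g` non-empty. The stabilizers consist of units that are positive at the places of
`W ≠ ∅`; they contain no root of unity but `1`, so by Dirichlet's unit theorem they embed in
`ℤ ^ (n - 1)` and have homological dimension at most `n - 1`
(`homologyVanishesAbove_of_injective`). As `i + n - 1 > n - 1`, this gives
the vanishing of `H_i(E, 𝒦_W)`.

For `B(W)`, the construction is an induction from `F_(T)` to `Fˣ`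
(`homologyVanishesAbove_twistedIndRep`), so Shapiro's lemma reduces the claim to the action of
`F_(T)` on `𝒦 ⊗ 𝒜 ⊗ ℤ[N^S]`. Prime ideals have infinite order in the group of fractional ideals,
so the factors `1 - c[𝔭]`, `c ≠ 0`, of the generator of `𝒜` are not zero divisors and `𝒜` is free
of rank one over `ℤ[𝖨_(T)]` (`aModEquiv`). Thus `𝒦 ⊗ 𝒜 ⊗ ℤ[N^S]` is the module of finitely supported
`𝒦`-valued functions on `𝖨_(T) × N^S`. An element of `F_(T)` fixes a point of this set if and only
if it is a unit, and the homology is again governed by that of the unit group with values in `𝒦`,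
where the index set `W̄ ∩ S_∞` is non-empty because `V` does not contain all infinite places.

Both parts use the same form of Shapiro's lemma, `Representation.HomologyVanishesAbove.of_orbits`,
for functions on a `G`-set on which all points have the same stabilizer.
-/

section Homology

open CategoryTheory CategoryTheory.Limits

universe u

namespace Representation

/-! ### Vanishing of group homology above a given degree -/

section Vanishing

variable {k G H : Type u} [CommRing k] [Group G] [Group H]
variable {V A B C : Type u} [AddCommGroup V] [Module k V] [AddCommGroup A] [Module k A]
  [AddCommGroup B] [Module k B] [AddCommGroup C] [Module k C]

/-- The homology of the representation `ρ` vanishes in all degrees strictly above `d`. -/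
def HomologyVanishesAbove (d : ℕ) (ρ : Representation k G V) : Prop :=
  ∀ i : ℕ, d < i → IsZero (groupHomology (Rep.of ρ) i)

lemma HomologyVanishesAbove.mono {d e : ℕ} (h : d ≤ e) {ρ : Representation k G V}
    (hρ : ρ.HomologyVanishesAbove d) : ρ.HomologyVanishesAbove e :=
  fun i hi => hρ i (h.trans_lt hi)

lemma HomologyVanishesAbove.of_equiv {d : ℕ} {ρ : Representation k G A} {σ : Representation k H B}
    (ψ : G ≃* H) (e : A ≃ₗ[k] B) (he : ∀ g a, e (ρ g a) = σ (ψ g) (e a))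
    (h : ρ.HomologyVanishesAbove d) : σ.HomologyVanishesAbove d := fun i hi =>
  (h i hi).of_iso (groupHomology.mapIso (A := Rep.of ρ) (B := Rep.of σ) ψ e
    (fun g => LinearMap.ext fun a => he g a) i).symm

section ShortExact

variable {ρ : Representation k G A} {σ : Representation k G B} {τ : Representation k G C}

lemma shortExact_of_intertwiningMap (f : ρ.IntertwiningMap σ) (g : σ.IntertwiningMap τ)
    (hf : Function.Injective f) (hg : Function.Surjective g) (hfg : Function.Exact f g) :
    (ShortComplex.mk (Rep.ofHom f) (Rep.ofHom g) (by
      ext x; exact hfg.apply_apply_eq_zero x)).ShortExact where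
  exact := by
    rw [← ShortComplex.exact_map_iff_of_faithful _ (forget₂ (Rep k G) (ModuleCat k)),
      ShortComplex.moduleCat_exact_iff]
    exact fun x hx => (hfg x).1 hx
  mono_f := (Rep.mono_iff_injective _).2 hf
  epi_g := (Rep.epi_iff_surjective _).2 hg

/-- Exactness of `H_{i+1}(τ) → H_i(ρ) → H_i(σ)` for `0 → ρ → σ → τ → 0`. -/
lemma HomologyVanishesAbove.of_shortExact_left {d : ℕ}
    (f : ρ.IntertwiningMap σ) (g : σ.IntertwiningMap τ)
    (hf : Function.Injective f) (hg : Function.Surjective g) (hfg : Function.Exact f g)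
    (hσ : σ.HomologyVanishesAbove d) (hτ : τ.HomologyVanishesAbove (d + 1)) :
    ρ.HomologyVanishesAbove d := fun i hi =>
  (groupHomology.mapShortComplex₁_exact (shortExact_of_intertwiningMap f g hf hg hfg)
    (rfl : i + 1 = i + 1)).isZero_X₂ ((hτ (i + 1) (by omega)).eq_of_src _ _)
    ((hσ i hi).eq_of_tgt _ _)

/-- Exactness of `H_{i+1}(σ) → H_{i+1}(τ) → H_i(ρ)` for `0 → ρ → σ → τ → 0`. -/
lemma HomologyVanishesAbove.of_shortExact_right {d : ℕ}
    (f : ρ.IntertwiningMap σ) (g : σ.IntertwiningMap τ)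
    (hf : Function.Injective f) (hg : Function.Surjective g) (hfg : Function.Exact f g)
    (hρ : ρ.HomologyVanishesAbove d) (hσ : σ.HomologyVanishesAbove (d + 1)) :
    τ.HomologyVanishesAbove (d + 1) := fun i hi => by
  obtain ⟨j, rfl⟩ : ∃ j, i = j + 1 := ⟨i - 1, by omega⟩
  exact (groupHomology.mapShortComplex₃_exact (shortExact_of_intertwiningMap f g hf hg hfg)
    (rfl : j + 1 = j + 1)).isZero_X₂ ((hσ (j + 1) hi).eq_of_src _ _)
    ((hρ j (by omega)).eq_of_tgt _ _)

end ShortExact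

open groupHomology in
lemma isZero_groupHomology_succ_iff (ρ : Representation k G V) (i : ℕ) :
    IsZero (groupHomology (Rep.of ρ) (i + 1)) ↔ ∀ z : (Fin (i + 1) → G) →₀ V,
      inhomogeneousChains.d (Rep.of ρ) i z = 0 →
        ∃ y : (Fin (i + 2) → G) →₀ V, inhomogeneousChains.d (Rep.of ρ) (i + 1) y = z := by
  rw [groupHomology, ← HomologicalComplex.exactAt_iff_isZero_homology,
    HomologicalComplex.exactAt_iff' _ (i + 2) (i + 1) i (by simp) (by simp),
    ShortComplex.moduleCat_exact_iff, ← inhomogeneousChains.d_def (Rep.of ρ) i,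
    ← inhomogeneousChains.d_def (Rep.of ρ) (i + 1)]
  rfl

open groupHomology in
lemma d_mapRange {ρ : Representation k G A} {σ : Representation k G B}
    (f : ρ.IntertwiningMap σ) (i : ℕ) (z : (Fin (i + 1) → G) →₀ A) :
    inhomogeneousChains.d (Rep.of σ) i (Finsupp.mapRange.linearMap f.toLinearMap z) =
      Finsupp.mapRange.linearMap f.toLinearMap (inhomogeneousChains.d (Rep.of ρ) i z) := by
  let φ : Rep.of ρ ⟶ Rep.of σ := Rep.ofHom f
  have h := (chainsMap (A := Rep.of ρ) (B := Rep.of σ) (MonoidHom.id G) φ).comm (i + 1) i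
  rw [inhomogeneousChains.d_def, inhomogeneousChains.d_def] at h
  have h2 := congr($(h) z)
  simpa [φ] using h2

/-- A cycle with values in a direct sum has only finitely many non-zero components, and each of them
is a cycle, hence a boundary. -/
lemma HomologyVanishesAbove.finsupp {d : ℕ} {ρ : Representation k G V}
    (h : ρ.HomologyVanishesAbove d) (R : Type u) : (ρ.finsupp R).HomologyVanishesAbove d := by
  classical
  intro i hi
  obtain ⟨j, rfl⟩ : ∃ j, i = j + 1 := ⟨i - 1, by omega⟩
  have h' := (isZero_groupHomology_succ_iff ρ j).1 (h _ hi)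
  rw [isZero_groupHomology_succ_iff]
  intro z hz
  let p (r : R) : (ρ.finsupp R).IntertwiningMap ρ :=
    ⟨Finsupp.lapply r, fun g => Finsupp.lhom_ext fun s v => by
      by_cases hs : s = r <;> simp [hs]⟩
  let q (r : R) : ρ.IntertwiningMap (ρ.finsupp R) :=
    ⟨Finsupp.lsingle r, fun g => by ext; simp⟩
  choose y hy using fun r => h' (Finsupp.mapRange.linearMap (p r).toLinearMap z)
    (by rw [d_mapRange, hz, map_zero])
  let s : Finset R := z.support.biUnion fun x => (z x).support
  refine ⟨∑ r ∈ s, Finsupp.mapRange.linearMap (q r).toLinearMap (y r), ?_⟩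
  rw [map_sum, Finset.sum_congr rfl fun r _ => (d_mapRange (q r) (j + 1) (y r)).trans
    (congrArg _ (hy r))]
  ext x : 1
  rw [Finsupp.finsetSum_apply]
  have key : (∑ r ∈ s, Finsupp.single r (z x r)) = z x := by
    rw [← Finsupp.sum_of_support_subset (z x) (s := s) _ (fun r => Finsupp.single r) (by simp)]
    · exact Finsupp.sum_single _
    · intro r hr
      refine Finset.mem_biUnion.2 ⟨x, ?_, hr⟩
      rw [Finsupp.mem_support_iff]
      rintro h0
      simp [h0] at hr
  exact key

end Vanishing

/-! ### Functions on a `G`-set with constant stabilizers -/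

section Orbits

variable {k G : Type u} [CommRing k] [Group G]
variable {V A : Type u} [AddCommGroup V] [Module k V] [AddCommGroup A] [Module k A]

/-- The relation `[sh ⊗ sa] = [h ⊗ a]` in an induced module. -/
lemma IndV.mk_mul {H : Type u} [Group H] (φ : H →* G) (ρ : Representation k H V) (s : H) (h : G)
    (a : V) : IndV.mk φ ρ (φ s * h) (ρ s a) = IndV.mk φ ρ h a := by
  have := Coinvariants.mk_self_apply (Representation.tprod
    (MonoidHom.comp (leftRegular k G) φ : Representation k H _) ρ) s
    (MonoidAlgebra.single h 1 ⊗ₜ a)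
  simpa using this

/-- Let `A` be the module of finitely supported `V`-valued functions on a `G`-set all of whose point
stabilizers equal `S`, with the diagonal action. Choosing a point in each orbit identifies `A` with
the module induced from a direct sum of copies of `V` as a representation of `S`, so that Shapiro's
lemma applies. -/
theorem HomologyVanishesAbove.of_orbits {d : ℕ} {Ω : Type u} [MulAction G Ω] (S : Subgroup G)
    (hS : ∀ (ω : Ω) (g : G), g • ω = ω ↔ g ∈ S) (ρ : Representation k G V)
    (σ : Representation k G A) (e : (Ω →₀ V) ≃ₗ[k] A)
    (he : ∀ (g : G) (ω : Ω) (v : V),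
      σ g (e (Finsupp.single ω v)) = e (Finsupp.single (g • ω) (ρ g v)))
    (h : HomologyVanishesAbove d (ρ.comp S.subtype)) : σ.HomologyVanishesAbove d := by
  classical
  let R := MulAction.orbitRel.Quotient G Ω
  let τ : Representation k S (R →₀ V) := Representation.finsupp (ρ.comp S.subtype) R
  -- `t ω` carries the chosen point of the orbit of `ω` to `ω`
  have ht : ∀ ω : Ω, ∃ t : G, t • (Quotient.mk (MulAction.orbitRel G Ω) ω).out = ω := fun ω =>
    (MulAction.orbitRel G Ω).symm (Quotient.mk_out (s := MulAction.orbitRel G Ω) ω)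
  choose t ht using ht
  let F₀ : τ.IntertwiningMap (σ.comp S.subtype) :=
    ⟨e.toLinearMap ∘ₗ Finsupp.lmapDomain V k (fun r : R => r.out), fun s => by
      ext r v
      have := (hS r.out (s : G)).2 s.2
      simp [τ, he, this]⟩
  let F : IndV S.subtype τ →ₗ[k] A := ((Rep.indResHomEquiv S.subtype (Rep.of τ) (Rep.of σ)).symm
    (Rep.ofHom F₀)).hom.toLinearMap
  have hF : ∀ h r v, F (IndV.mk S.subtype τ h (Finsupp.single r v)) =
      e (Finsupp.single (h⁻¹ • r.out) (ρ h⁻¹ v)) := by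
    intro h r v
    simp [F, F₀, Rep.indResHomEquiv, he]
  let J : (Ω →₀ V) →ₗ[k] IndV S.subtype τ := Finsupp.lsum k fun ω =>
    IndV.mk S.subtype τ (t ω)⁻¹ ∘ₗ Finsupp.lsingle (Quotient.mk (MulAction.orbitRel G Ω) ω) ∘ₗ
      ρ (t ω)⁻¹
  have hJ : ∀ ω v, J (Finsupp.single ω v) = IndV.mk S.subtype τ (t ω)⁻¹
      (Finsupp.single (Quotient.mk (MulAction.orbitRel G Ω) ω) (ρ (t ω)⁻¹ v)) := by
    intro ω v; simp [J]
  have h₁ : F ∘ₗ (J ∘ₗ e.symm.toLinearMap) = LinearMap.id := by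
    refine LinearMap.ext fun a => ?_
    obtain ⟨f, rfl⟩ := e.surjective a
    simp only [LinearMap.comp_apply, LinearEquiv.coe_coe, LinearEquiv.symm_apply_apply,
      LinearMap.id_apply]
    induction f using Finsupp.induction_linear with
    | zero => simp
    | add f g hf hg => simp only [map_add, hf, hg]
    | single ω v => rw [hJ, hF, inv_inv, ht, self_inv_apply]
  have h₂ : (J ∘ₗ e.symm.toLinearMap) ∘ₗ F = LinearMap.id := by
    refine IndV.hom_ext _ _ fun h => Finsupp.lhom_ext fun r v => ?_
    change J (e.symm (F (IndV.mk S.subtype τ h (Finsupp.single r v)))) =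
      IndV.mk S.subtype τ h (Finsupp.single r v)
    rw [hF, LinearEquiv.symm_apply_apply, hJ]
    have hr : Quotient.mk (MulAction.orbitRel G Ω) (h⁻¹ • r.out) = r := by
      rw [← Quotient.out_eq r]
      exact Quotient.sound ⟨h⁻¹, by simp⟩
    set g := t (h⁻¹ • r.out) with hg
    have hgr : g • r.out = h⁻¹ • r.out := by
      have := ht (h⁻¹ • r.out)
      rwa [hr] at this
    -- `h * t (h⁻¹ • r)` fixes the chosen point of the orbit `r`, so it lies in `S`
    have hs : (h * g)⁻¹ ∈ S := by
      rw [← hS r.out, inv_smul_eq_iff, mul_smul, hgr, smul_inv_smul]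
    rw [hr, ← IndV.mk_mul S.subtype τ ⟨_, hs⟩ h]
    congr 1
    · simp
    · simp [τ, ← Module.End.mul_apply, ← map_mul]
  refine HomologyVanishesAbove.of_equiv (ρ := ind S.subtype τ) (MulEquiv.refl G)
    (LinearEquiv.ofLinearMap F (J ∘ₗ e.symm.toLinearMap) h₁ h₂) ?_ fun i hi =>
    (h.finsupp R i hi).of_iso (groupHomology.indIso S (Rep.of τ) i)
  exact fun g a => Rep.hom_comm_apply ((Rep.indResHomEquiv S.subtype (Rep.of τ) (Rep.of σ)).symm
    (Rep.ofHom F₀)) g a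

end Orbits

/-! ### The homological dimension of subgroups of `ℤ ^ r` -/

section Cd

variable {k G : Type u} [CommRing k] [Group G] {V : Type u} [AddCommGroup V] [Module k V]

lemma homologyVanishesAbove_of_subsingleton [Subsingleton G] (ρ : Representation k G V) (d : ℕ) :
    ρ.HomologyVanishesAbove d := fun i hi => by
  obtain ⟨j, rfl⟩ : ∃ j, i = j + 1 := ⟨i - 1, by omega⟩
  exact isZero_groupHomology_succ_of_subsingleton _ j

/-- The representation of `G` on the `V`-valued finitely supported functions on a `G`-set `Ω` in
which `g` moves the value `v` at `ω` to the value `ρ g v` at `g • ω`. -/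
noncomputable def permFinsupp (Ω : Type*) [MulAction G Ω] (ρ : Representation k G V) :
    Representation k G (Ω →₀ V) where
  toFun g := Finsupp.lsum k fun ω => Finsupp.lsingle (g • ω) ∘ₗ ρ g
  map_one' := Finsupp.lhom_ext fun ω v => by simp
  map_mul' g h := Finsupp.lhom_ext fun ω v => by simp [mul_smul]

lemma permFinsupp_single {Ω : Type*} [MulAction G Ω] (ρ : Representation k G V) (g : G) (ω : Ω)
    (v : V) : ρ.permFinsupp Ω g (Finsupp.single ω v) = Finsupp.single (g • ω) (ρ g v) := by
  simp [permFinsupp]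

lemma HomologyVanishesAbove.permFinsupp {d : ℕ} {Ω : Type u} [MulAction G Ω] (S : Subgroup G)
    (hS : ∀ (ω : Ω) (g : G), g • ω = ω ↔ g ∈ S) (ρ : Representation k G V)
    (h : HomologyVanishesAbove d (ρ.comp S.subtype)) :
    (ρ.permFinsupp Ω).HomologyVanishesAbove d :=
  .of_orbits S hS ρ _ (LinearEquiv.refl k _) (permFinsupp_single ρ) h

end Cd

section Shift

variable (k V : Type*) [CommRing k] [AddCommGroup V] [Module k V]

/-- The difference `t - 1` on `ℤ →₀ V`, where `t` is the translation by `1`. -/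
noncomputable def shiftSub : (ℤ →₀ V) →ₗ[k] (ℤ →₀ V) :=
  Finsupp.lmapDomain V k (· + 1) - LinearMap.id

/-- The sum of the values of an element of `ℤ →₀ V`. -/
noncomputable def sumValues : (ℤ →₀ V) →ₗ[k] V := Finsupp.lsum k fun _ => LinearMap.id

variable {V}

lemma shiftSub_single (m : ℤ) (v : V) :
    shiftSub k V (Finsupp.single m v) = Finsupp.single (m + 1) v - Finsupp.single m v := by
  simp [shiftSub]

lemma sumValues_single (m : ℤ) (v : V) : sumValues k V (Finsupp.single m v) = v := by
  simp [sumValues]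

lemma sumValues_surjective : Function.Surjective (sumValues k V) :=
  fun v => ⟨_, sumValues_single k 0 v⟩

lemma shiftSub_injective : Function.Injective (shiftSub k V) := by
  rw [injective_iff_map_eq_zero]
  intro x hx
  have hx' : Finsupp.mapDomain (· + 1) x = x := sub_eq_zero.1 hx
  by_contra h0
  -- the largest point of the support would be followed by another one
  obtain ⟨m, hm, hmax⟩ := x.support.exists_max_image id (Finsupp.support_nonempty_iff.2 h0)
  have h1 : x (m + 1) = x m := by
    conv_lhs => rw [← hx']
    exact Finsupp.mapDomain_apply (add_left_injective 1) x m
  have := hmax (m + 1) (by rw [Finsupp.mem_support_iff, h1]; exact Finsupp.mem_support_iff.1 hm)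
  simp at this

lemma exact_shiftSub_sumValues : Function.Exact (shiftSub k V) (sumValues k V) := by
  have h1 : ∀ (v : V) (m : ℤ), Finsupp.single m v - Finsupp.single 0 v ∈
      LinearMap.range (shiftSub k V) := by
    intro v m
    induction m using Int.induction_on with
    | zero => simp
    | succ i h =>
      have := add_mem h ⟨_, shiftSub_single k (i : ℤ) v⟩
      simpa using this
    | pred i h =>
      have := sub_mem h ⟨_, shiftSub_single k (-i - 1 : ℤ) v⟩
      simpa using this
  have h2 : ∀ x, x - Finsupp.single 0 (sumValues k V x) ∈ LinearMap.range (shiftSub k V) := by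
    intro x
    induction x using Finsupp.induction_linear with
    | zero => simp
    | add f g hf hg =>
      have := add_mem hf hg
      rwa [sub_add_sub_comm, ← Finsupp.single_add, ← map_add] at this
    | single m v => rw [sumValues_single]; exact h1 v m
  intro x
  constructor
  · intro hx
    have := h2 x
    rwa [hx, Finsupp.single_zero, sub_zero] at this
  · rintro ⟨y, rfl⟩
    induction y using Finsupp.induction_linear with
    | zero => simp
    | add f g hf hg => rw [map_add, map_add, hf, hg, add_zero]
    | single m v => rw [shiftSub_single, map_sub, sumValues_single, sumValues_single, sub_self]

end Shift

variable {k : Type} [CommRing k]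

/-- If `N` is the kernel of a homomorphism `G → ℤ`, the homological dimension of `G` is at most one
more than that of `N`: let `G` act on `ℤ` by translations and use the exact sequence
`0 → V[ℤ] → V[ℤ] → V → 0` with first map `t - 1`. -/
lemma HomologyVanishesAbove.of_ker {G : Type} [Group G] {V : Type} [AddCommGroup V]
    [Module k V] {d : ℕ} (deg : G →* Multiplicative ℤ) (ρ : Representation k G V)
    (h : HomologyVanishesAbove d (ρ.comp deg.ker.subtype)) : ρ.HomologyVanishesAbove (d + 1) := by
  let : MulAction G ℤ :=
    { smul g m := (deg g).toAdd + m
      one_smul m := by change (deg 1).toAdd + m = m; simp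
      mul_smul g h m := by
        change (deg (g * h)).toAdd + m = (deg g).toAdd + ((deg h).toAdd + m)
        simp [add_assoc] }
  have hsmul : ∀ (g : G) (m : ℤ), g • m = (deg g).toAdd + m := fun _ _ => rfl
  have hP : (ρ.permFinsupp ℤ).HomologyVanishesAbove d :=
    HomologyVanishesAbove.permFinsupp deg.ker (fun m g => by
      rw [hsmul, MonoidHom.mem_ker, add_eq_right]; exact toAdd_eq_zero) ρ h
  refine .of_shortExact_right (ρ := ρ.permFinsupp ℤ) (σ := ρ.permFinsupp ℤ)
    ⟨shiftSub k V, fun g => Finsupp.lhom_ext fun m v => ?_⟩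
    ⟨sumValues k V, fun g => Finsupp.lhom_ext fun m v => ?_⟩
    (shiftSub_injective k) (sumValues_surjective k) (exact_shiftSub_sumValues k) hP
    (hP.mono (Nat.le_succ d))
  · simp [permFinsupp_single, shiftSub_single, hsmul, add_assoc]
  · simp [permFinsupp_single, sumValues_single]

/-- A group that embeds in `ℤ ^ r` has homological dimension at most `r`. -/
theorem homologyVanishesAbove_of_injective (r : ℕ) : ∀ {G : Type} [Group G]
    (f : G →* (Fin r → Multiplicative ℤ)), Function.Injective f → ∀ {V : Type} [AddCommGroup V]
    [Module k V] (ρ : Representation k G V), ρ.HomologyVanishesAbove r := by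
  induction r with
  | zero =>
    intro G _ f hf V _ _ ρ
    have := hf.subsingleton
    exact homologyVanishesAbove_of_subsingleton ρ 0
  | succ r ih =>
    intro G _ f hf V _ _ ρ
    let deg : G →* Multiplicative ℤ := (Pi.evalMonoidHom _ 0).comp f
    refine .of_ker deg ρ (ih (G := deg.ker) ((MonoidHom.pi fun i : Fin r =>
      (Pi.evalMonoidHom _ i.succ).comp f).comp deg.ker.subtype) ?_ _)
    intro x y hxy
    refine Subtype.ext (hf (funext fun i => ?_))
    induction i using Fin.cases with
    | zero => exact (MonoidHom.mem_ker.1 x.2).trans (MonoidHom.mem_ker.1 y.2).symm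
    | succ i => exact congrFun hxy i

/-! ### Induced modules given by a presentation -/

section TensorFinsupp

variable {k K A I N : Type*} [CommRing k] [AddCommGroup K] [Module k K] [AddCommGroup A]
  [Module k A]

open scoped Classical in
/-- `(K ⊗ A) ⊗ k[N]` as the `K`-valued finitely supported functions on `I × N`, for a module `A`
with a basis indexed by `I`. -/
noncomputable def tensorFinsuppEquiv (a : (I →₀ k) ≃ₗ[k] A) :
    (I × N →₀ K) ≃ₗ[k] (K ⊗[k] A) ⊗[k] MonoidAlgebra k N :=
  (TensorProduct.finsuppScalarRight k k K (I × N)).symm ≪≫ₗ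
    (finsuppTensorFinsupp' k I N).symm.lTensor K ≪≫ₗ
    (_root_.TensorProduct.assoc k K (I →₀ k) (N →₀ k)).symm ≪≫ₗ
    TensorProduct.congr (a.lTensor K) (MonoidAlgebra.coeffLinearEquiv k).symm

open scoped Classical in
lemma tensorFinsuppEquiv_single (a : (I →₀ k) ≃ₗ[k] A) (i : I) (n : N) (v : K) :
    tensorFinsuppEquiv a (Finsupp.single (i, n) v) =
      (v ⊗ₜ a (Finsupp.single i 1)) ⊗ₜ MonoidAlgebra.single n 1 := by
  simp [tensorFinsuppEquiv, finsuppTensorFinsupp'_symm_single_eq_single_one_tmul]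

end TensorFinsupp

section Induced

variable {k G M B : Type u} [CommRing k] [CommGroup G] [AddCommGroup M] [Module k M]
  [AddCommGroup B] [Module k B]

variable (k G M) in
/-- The isomorphism `k[G] ⊗ M ≃ M ⊗ k[G]`, `g ⊗ m ↦ m ⊗ g⁻¹`. The inverse turns the action
`g ↦ gy⁻¹` of `y` in `Representation.ind` into the multiplication by `y`. -/
noncomputable def commInv : MonoidAlgebra k G ⊗[k] M ≃ₗ[k] M ⊗[k] MonoidAlgebra k G :=
  (MonoidAlgebra.mapDomainLinearEquiv k k (Equiv.inv G)).rTensor M ≪≫ₗ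
    _root_.TensorProduct.comm k (MonoidAlgebra k G) M

lemma commInv_single_tmul (g : G) (r : k) (m : M) :
    commInv k G M (MonoidAlgebra.single g r ⊗ₜ m) = m ⊗ₜ MonoidAlgebra.single g⁻¹ r := by
  simp [commInv]

/-- Shapiro's lemma for a module `B` over an abelian group `G` that is presented as the quotient of
`M ⊗ k[G]` by the relations `xm ⊗ c = m ⊗ xc` with `x` in a subgroup `H`. -/
theorem HomologyVanishesAbove.of_presentation {d : ℕ} (H : Subgroup G) (τ : Representation k H M)
    (σ : Representation k G B) (p : M ⊗[k] MonoidAlgebra k G →ₗ[k] B)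
    (hp : Function.Surjective p)
    (hσ : ∀ y m c, σ y (p (m ⊗ₜ c)) = p (m ⊗ₜ (MonoidAlgebra.single y 1 * c)))
    (h₁ : ∀ (x : H) m c, p (τ x m ⊗ₜ c) = p (m ⊗ₜ (MonoidAlgebra.single (x : G) 1 * c)))
    (h₂ : LinearMap.ker p ≤ Submodule.span k {t | ∃ (x : H) (m : M) (c : MonoidAlgebra k G),
      t = τ x m ⊗ₜ c - m ⊗ₜ (MonoidAlgebra.single (x : G) 1 * c)})
    (h : τ.HomologyVanishesAbove d) : σ.HomologyVanishesAbove d := by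
  classical
  let E := commInv k G M
  have hE : ∀ g r m, E (MonoidAlgebra.single g r ⊗ₜ m) = m ⊗ₜ MonoidAlgebra.single g⁻¹ r :=
    commInv_single_tmul
  let Φ : IndV H.subtype τ →ₗ[k] B := Coinvariants.lift _ (p ∘ₗ E.toLinearMap) fun x => by
    refine TensorProduct.ext <| MonoidAlgebra.lhom_ext' fun g => LinearMap.ext_ring <|
      LinearMap.ext fun m => ?_
    suffices hs : p (E (MonoidAlgebra.single ((x : G) * g) 1 ⊗ₜ τ x m)) =
        p (E (MonoidAlgebra.single g 1 ⊗ₜ m)) by simpa using hs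
    rw [hE, hE, h₁, MonoidAlgebra.single_mul_single, mul_inv_rev, mul_one, mul_comm g⁻¹,
      mul_inv_cancel_left]
  have hΦ : ∀ z, Φ (Coinvariants.mk _ z) = p (E z) := fun z => rfl
  have hmk : ∀ t ∈ LinearMap.ker p, Coinvariants.mk
      (Representation.tprod (MonoidHom.comp (leftRegular k G) H.subtype :
        Representation k H _) τ) (E.symm t) = 0 := by
    intro t ht
    refine (Submodule.span_le (p := LinearMap.ker (Coinvariants.mk (Representation.tprod
      (MonoidHom.comp (leftRegular k G) H.subtype : Representation k H _) τ) ∘ₗ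
      E.symm.toLinearMap))).2 ?_ (h₂ ht)
    rintro _ ⟨x, m, c, rfl⟩
    rw [SetLike.mem_coe, LinearMap.mem_ker, map_sub, sub_eq_zero]
    induction c using MonoidAlgebra.induction_linear with
    | zero => simp
    | add c c' hc hc' => simp only [TensorProduct.tmul_add, mul_add, map_add, hc, hc']
    | single g r =>
      have hEs : ∀ g r m, E.symm (m ⊗ₜ MonoidAlgebra.single g r) =
          MonoidAlgebra.single g⁻¹ r ⊗ₜ m := fun g r m => by
        rw [LinearEquiv.symm_apply_eq, hE, inv_inv]
      have := Coinvariants.mk_self_apply (Representation.tprod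
        (MonoidHom.comp (leftRegular k G) H.subtype : Representation k H _) τ) x
        (MonoidAlgebra.single ((x : G) * g)⁻¹ r ⊗ₜ m)
      simpa [hEs, MonoidAlgebra.single_mul_single] using this
  have hbij : Function.Bijective Φ := by
    constructor
    · rw [injective_iff_map_eq_zero]
      intro z
      induction z using Coinvariants.induction_on with
      | h z =>
        intro hz
        simpa using hmk (E z) hz
    · intro b
      obtain ⟨t, rfl⟩ := hp b
      exact ⟨Coinvariants.mk _ (E.symm t), by rw [hΦ, LinearEquiv.apply_symm_apply]⟩
  refine HomologyVanishesAbove.of_equiv (ρ := ind H.subtype τ) (MulEquiv.refl G)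
    (LinearEquiv.ofBijective Φ hbij) ?_ fun i hi =>
    (h i hi).of_iso (groupHomology.indIso H (Rep.of τ) i)
  intro y z
  suffices hs : Φ ∘ₗ ind H.subtype τ y = σ y ∘ₗ Φ from LinearMap.congr_fun hs z
  refine IndV.hom_ext _ _ fun g => LinearMap.ext fun m => ?_
  change p (E (MonoidAlgebra.mapDomainLinearMap k k (fun x => x * y⁻¹)
    (MonoidAlgebra.single g 1) ⊗ₜ m)) = σ y (p (E (MonoidAlgebra.single g 1 ⊗ₜ m)))
  rw [hE, hσ, MonoidAlgebra.single_mul_single]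
  simp [hE]

end Induced

end Representation

end Homology

noncomputable section

namespace ShintaniDatum

open Representation

/-! ### Units of a totally real field -/

variable {F : Type} [Field F] [NumberField F]

/-- **Dirichlet's unit theorem**: recording the exponents with respect to a system of fundamental
units embeds the unit group modulo torsion in `ℤ ^ r`. -/
lemma exists_hom_ker_le_torsion (F : Type) [Field F] [NumberField F] :
    ∃ f : (𝓞 F)ˣ →* (Fin (Units.rank F) → Multiplicative ℤ), f.ker ≤ Units.torsion F := by
  choose c hc hu using Units.exist_unique_eq_mul_prod F
  refine ⟨MonoidHom.mk' (fun x i => Multiplicative.ofAdd ((c x).2 i)) fun x y => ?_, fun x hx => ?_⟩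
  · have h : x * y = (c x).1 * (c y).1 * ∏ i, Units.fundSystem F i ^ ((c x).2 i + (c y).2 i) := by
      simp_rw [zpow_add, Finset.prod_mul_distrib]
      rw [mul_mul_mul_comm, ← hc, ← hc]
    rw [← hu (x * y) ((c x).1 * (c y).1, fun i => (c x).2 i + (c y).2 i) h]
    rfl
  · have h : ∀ i, (c x).2 i = 0 := fun i => congrFun hx i
    rw [hc x]
    simp [h]

-- As in the definitions of the modules concerned, `Module ℤ` instances are to come from the
-- construction of a module and not from its underlying additive group.
attribute [-instance] AddCommGroup.toIntModule

section Positive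

variable [IsTotallyReal F]

lemma units_rank_eq (F : Type) [Field F] [NumberField F] [IsTotallyReal F] :
    Units.rank F = Module.finrank ℚ F - 1 := by
  rw [Units.rank, IsTotallyReal.finrank, InfinitePlace.card_eq_nrRealPlaces_add_nrComplexPlaces,
    IsTotallyReal.nrComplexPlaces_eq_zero, add_zero]

omit [NumberField F] in
lemma realUnit_pos_of_signDiag_eq_one {W : Finset (InfinitePlace F)} {x : Fˣ} (h : signDiag W x = 1)
    {v : InfinitePlace F} (hv : v ∈ W) : 0 < (realUnit v x : ℝ) := by
  have h1 : (QuotientGroup.mk' (Units.posSubgroup ℝ)) (realUnit v x) = 1 :=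
    congrFun h ⟨v, hv⟩
  exact (QuotientGroup.eq_one_iff _).1 h1

omit [NumberField F] in
/-- A root of unity that is positive at some real place is `1`. -/
lemma eq_one_of_mem_torsion {W : Finset (InfinitePlace F)} (hW : W.Nonempty) {u : (𝓞 F)ˣ}
    (hu : u ∈ Units.torsion F)
    (h : signDiag W (Units.map (algebraMap (𝓞 F) F).toMonoidHom u) = 1) : u = 1 := by
  obtain ⟨v, hv⟩ := hW
  have hpos := realUnit_pos_of_signDiag_eq_one h hv
  obtain ⟨m, hm, hum⟩ := isOfFinOrder_iff_pow_eq_one.1 ((CommGroup.mem_torsion _).1 hu)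
  let φ : (𝓞 F)ˣ →* ℝˣ := (realUnit v).comp (Units.map (algebraMap (𝓞 F) F).toMonoidHom)
  have h1 : ((φ u : ℝˣ) : ℝ) = 1 := by
    refine (pow_eq_one_iff_of_nonneg hpos.le hm.ne').1 ?_
    change ((φ u : ℝˣ) : ℝ) ^ m = 1
    rw [← Units.val_pow_eq_pow_val, ← map_pow, hum, map_one, Units.val_one]
  have h2 : Function.Injective φ :=
    (Units.map_injective (RingHom.injective _)).comp
      (Units.map_injective (FaithfulSMul.algebraMap_injective (𝓞 F) F))
  exact h2 ((Units.ext h1).trans (map_one φ).symm)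

end Positive

/-! ### The complex of chains -/

section Chains

variable {F : Type} [Field F] [NumberField F] [IsTotallyReal F]
variable {T : Finset (Place F)} {W : Finset (InfinitePlace F)}

/-- The symbol `(x, x₁, …, x_k)⟦g⟧` obtained from `s = (x₁, …, x_k)⟦g⟧` and `x ∈ F_g`. -/
def consSymbol {k : ℕ} (s : Symbols T W k) (x : SignClass T W s.1) : Symbols T W (k + 1) :=
  ⟨s.1, Fin.cons x s.2⟩

/-- The symbol `(x₁, …, x̂ᵢ, …, x_k)⟦g⟧`. -/
def faceSymbol {k : ℕ} (i : Fin (k + 1)) (s : Symbols T W (k + 1)) : Symbols T W k :=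
  ⟨s.1, fun j => s.2 (i.succAbove j)⟩

lemma boundary_single {k : ℕ} (s : Symbols T W (k + 1)) :
    boundary T W k (Finsupp.single s 1) =
      ∑ i : Fin (k + 1), Finsupp.single (faceSymbol i s) ((-1 : ℤ) ^ (i : ℕ)) := by
  rw [boundary, Finsupp.linearCombination_single, one_smul]
  rfl

lemma faceSymbol_zero_consSymbol {k : ℕ} (s : Symbols T W k) (x : SignClass T W s.1) :
    faceSymbol 0 (consSymbol s x) = s :=
  symbols_ext T W rfl fun j => by simp [faceSymbol, consSymbol]

lemma faceSymbol_succ_consSymbol {k : ℕ} (s : Symbols T W (k + 1)) (x : SignClass T W s.1)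
    (i : Fin (k + 1)) :
    faceSymbol i.succ (consSymbol s x) = consSymbol (faceSymbol i s) x :=
  symbols_ext T W rfl fun j => by
    induction j using Fin.cases with
    | zero => simp [faceSymbol, consSymbol]
    | succ j => simp [faceSymbol, consSymbol, Fin.succ_succAbove_succ]

open Classical in
/-- The cone operator `(x₁, …, x_k)⟦g⟧ ↦ (b_g, x₁, …, x_k)⟦g⟧` for a choice of base points
`b_g ∈ F_g`. It is zero on the summands with `F_g` empty, which can be non-zero for `k = 0` only. -/
def cone (b : ∀ g : SignSpace W, Nonempty (SignClass T W g) → SignClass T W g) (k : ℕ) :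
    Chains T W k →ₗ[ℤ] Chains T W (k + 1) :=
  Finsupp.linearCombination ℤ fun s =>
    if h : Nonempty (SignClass T W s.1) then Finsupp.single (consSymbol s (b s.1 h)) 1 else 0

variable (b : ∀ g : SignSpace W, Nonempty (SignClass T W g) → SignClass T W g)

lemma cone_single {k : ℕ} (s : Symbols T W k) (h : Nonempty (SignClass T W s.1)) (c : ℤ) :
    cone b k (Finsupp.single s c) = Finsupp.single (consSymbol s (b s.1 h)) c := by
  rw [cone, Finsupp.linearCombination_single, dif_pos h, Finsupp.smul_single, smul_eq_mul, mul_one]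

/-- The cone operator is a contracting homotopy in positive degrees. -/
lemma boundary_cone (k : ℕ) (c : Chains T W (k + 1)) :
    boundary T W (k + 1) (cone b (k + 1) c) = c - cone b k (boundary T W k c) := by
  suffices h : boundary T W (k + 1) ∘ₗ cone b (k + 1) =
      LinearMap.id - cone b k ∘ₗ boundary T W k from LinearMap.congr_fun h c
  refine Finsupp.lhom_ext' fun s => LinearMap.ext_ring ?_
  have hs : Nonempty (SignClass T W s.1) := ⟨s.2 0⟩
  simp only [LinearMap.comp_apply, LinearMap.sub_apply, LinearMap.id_apply, Finsupp.lsingle_apply]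
  rw [cone_single b s hs, boundary_single, Fin.sum_univ_succ, boundary_single, map_sum,
    faceSymbol_zero_consSymbol, Fin.val_zero, pow_zero, sub_eq_add_neg, ← Finset.sum_neg_distrib]
  congr 1
  refine Finset.sum_congr rfl fun i _ => ?_
  rw [faceSymbol_succ_consSymbol, cone_single b (faceSymbol i s) hs, Fin.val_succ, pow_succ,
    mul_neg_one, Finsupp.single_neg]
  rfl

lemma boundary_zero_cone_boundary (c : Chains T W 1) :
    boundary T W 0 (cone b 0 (boundary T W 0 c)) = boundary T W 0 c := by
  suffices h : boundary T W 0 ∘ₗ cone b 0 ∘ₗ boundary T W 0 = boundary T W 0 from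
    LinearMap.congr_fun h c
  refine Finsupp.lhom_ext' fun s => LinearMap.ext_ring ?_
  have hs : Nonempty (SignClass T W s.1) := ⟨s.2 0⟩
  simp only [LinearMap.comp_apply, Finsupp.lsingle_apply]
  have h1 : boundary T W 0 (Finsupp.single s 1) = Finsupp.single (faceSymbol 0 s) 1 := by
    rw [boundary_single]; simp
  rw [h1, cone_single b (faceSymbol 0 s) hs, boundary_single]
  simp [faceSymbol_zero_consSymbol]

open Classical in
lemma exists_cone_faceSymbol {k : ℕ} (s : Symbols T W (k + 1)) :
    ∃ b : ∀ g : SignSpace W, Nonempty (SignClass T W g) → SignClass T W g,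
      cone b k (Finsupp.single (faceSymbol 0 s) 1) = Finsupp.single s 1 := by
  let b : ∀ g : SignSpace W, Nonempty (SignClass T W g) → SignClass T W g := fun g h =>
    if hg : s.1 = g then hg ▸ s.2 0 else h.some
  have hb : ∀ h, b s.1 h = s.2 0 := fun h => dif_pos rfl
  refine ⟨b, ?_⟩
  rw [cone_single b (faceSymbol 0 s) ⟨s.2 0⟩]
  congr 1
  refine symbols_ext T W rfl fun j => ?_
  induction j using Fin.cases with
  | zero => exact congrArg Subtype.val (hb _)
  | succ j => simp [consSymbol, faceSymbol]

/-- Every symbol of positive length is a cone, so `d² = 0` follows from the homotopy formula by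
induction on the length. -/
lemma boundary_boundary (k : ℕ) (c : Chains T W (k + 2)) :
    boundary T W k (boundary T W (k + 1) c) = 0 := by
  suffices h : boundary T W k ∘ₗ boundary T W (k + 1) = 0 from LinearMap.congr_fun h c
  clear c
  induction k with
  | zero =>
    refine Finsupp.lhom_ext' fun s => LinearMap.ext_ring ?_
    simp only [LinearMap.comp_apply, Finsupp.lsingle_apply]
    obtain ⟨b, hb⟩ := exists_cone_faceSymbol s
    rw [← hb, boundary_cone, map_sub, boundary_zero_cone_boundary, sub_self]
    rfl
  | succ k ih =>
    refine Finsupp.lhom_ext' fun s => LinearMap.ext_ring ?_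
    simp only [LinearMap.comp_apply, Finsupp.lsingle_apply]
    obtain ⟨b, hb⟩ := exists_cone_faceSymbol s
    have ih' := LinearMap.congr_fun ih (Finsupp.single (faceSymbol 0 s) 1)
    rw [LinearMap.comp_apply] at ih'
    rw [← hb, boundary_cone, map_sub, boundary_cone, ih', LinearMap.zero_apply, map_zero, sub_zero,
      sub_self]
    rfl

lemma range_boundary_succ (k : ℕ) :
    LinearMap.range (boundary T W (k + 1)) = LinearMap.ker (boundary T W k) := by
  refine le_antisymm ?_ fun c hc => ?_
  · rintro _ ⟨c, rfl⟩
    exact boundary_boundary k c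
  · refine ⟨cone (fun _ h => h.some) (k + 1) c, ?_⟩
    rw [boundary_cone, LinearMap.mem_ker.1 hc, map_zero, sub_zero]

end Chains

/-! ### The homology of `𝒦_W` for groups of units -/

section KMod

variable {F : Type} [Field F] [NumberField F] [IsTotallyReal F]
variable (T : Finset (Place F)) (W : Finset (InfinitePlace F))

/-- The action of `F_(T)` on `ℤ` through the sign character. -/
def sgnRep : Representation ℤ (elementsPrimeTo T) ℤ where
  toFun x := sgn (x : Fˣ) • LinearMap.id
  map_one' := by rw [Subgroup.coe_one, map_one, one_smul]; rfl
  map_mul' x y := by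
    rw [Subgroup.coe_mul, map_mul]
    ext
    simp

lemma chainsRep_single (k : ℕ) (x : elementsPrimeTo T) (s : Symbols T W k) (v : ℤ) :
    chainsRep T W k x (Finsupp.single s v) =
      Finsupp.single (symbolsMul T W k x s) (sgnRep T x v) := by
  change sgn (x : Fˣ) • Finsupp.mapDomain _ (Finsupp.single s v) = _
  rw [Finsupp.mapDomain_single, Finsupp.smul_single]
  rfl

/-- The action of `F_(T)` on `C_{k+1,W} / ker d_{k+1}`, which is isomorphic to the image of
`d_{k+1}` in `C_{k,W}`. For `k + 1 = [F : ℚ]` this is the action on `𝒦_W`. -/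
def imageRep (k : ℕ) : Representation ℤ (elementsPrimeTo T)
    (Chains T W (k + 1) ⧸ LinearMap.ker (boundary T W k)) :=
  (chainsRep T W (k + 1)).quotient _ (ker_boundary_le T W k)

lemma imageRep_mkQ (k : ℕ) (x : elementsPrimeTo T) (c : Chains T W (k + 1)) :
    imageRep T W k x ((LinearMap.ker (boundary T W k)).mkQ c) =
      (LinearMap.ker (boundary T W k)).mkQ (chainsRep T W (k + 1) x c) := rfl

variable {D : Type} [Group D] (f : D →* (𝓞 F)ˣ) (hf : Function.Injective f)

omit [IsTotallyReal F] in
lemma unitsToElements_injective : Function.Injective (unitsToElements (F := F) T) := fun _ _ h =>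
  Units.map_injective (FaithfulSMul.algebraMap_injective (𝓞 F) F) (congrArg Subtype.val h)

include hf

/-- A group of units acts freely on the symbols of positive length. -/
lemma homologyVanishesAbove_chainsRep (k : ℕ) : HomologyVanishesAbove 0
    (MonoidHom.comp (chainsRep T W (k + 1)) ((unitsToElements T).comp f)) := by
  let θ := (unitsToElements T).comp f
  have hθ : Function.Injective θ := (unitsToElements_injective T).comp hf
  let _ : MulAction D (Symbols T W (k + 1)) :=
    { smul x s := symbolsMul T W (k + 1) (θ x) s
      one_smul s := by
        change symbolsMul T W (k + 1) (θ 1) s = s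
        rw [map_one, symbolsMul_one]; rfl
      mul_smul x y s := by
        change symbolsMul T W (k + 1) (θ (x * y)) s = _
        rw [map_mul, symbolsMul_mul]; rfl }
  refine .of_orbits (⊥ : Subgroup D) (fun s x => ?_) (MonoidHom.comp (sgnRep T) θ) _
    (LinearEquiv.refl ℤ _) (fun x s v => chainsRep_single T W (k + 1) (θ x) s v)
    (homologyVanishesAbove_of_subsingleton _ 0)
  rw [Subgroup.mem_bot]
  constructor
  · intro h
    have h1 : θ x * (s.2 0).1 = (s.2 0).1 :=
      congrArg (fun s : Symbols T W (k + 1) => (s.2 0).1) h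
    exact hθ ((mul_eq_right.1 h1).trans (map_one θ).symm)
  · rintro rfl
    exact one_smul _ _

/-- Units that are positive at the places of `W` form a group without torsion, of rank at most
`[F : ℚ] - 1`. -/
lemma homologyVanishesAbove_of_signDiag_eq_one (hW : W.Nonempty)
    (h : ∀ x, signDiag W (unitsToElements T (f x) : Fˣ) = 1) {V : Type} [AddCommGroup V]
    [Module ℤ V] (ρ : Representation ℤ D V) :
    ρ.HomologyVanishesAbove (Module.finrank ℚ F - 1) := by
  obtain ⟨ℓ, hℓ⟩ := exists_hom_ker_le_torsion F
  rw [← units_rank_eq F]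
  refine homologyVanishesAbove_of_injective _ (ℓ.comp f) ?_ ρ
  rw [injective_iff_map_eq_one]
  intro x hx
  exact hf ((eq_one_of_mem_torsion hW (hℓ hx) (h x)).trans (map_one f).symm)

/-- `C_{1,W} / ker d_1` is the sign-twisted permutation module on the set of those `g` with `F_g`
non-empty, and the stabilizer of each `g` consists of units positive at the places of `W`. -/
lemma homologyVanishesAbove_imageRep_zero (hW : W.Nonempty) :
    HomologyVanishesAbove (Module.finrank ℚ F - 1)
      (MonoidHom.comp (imageRep T W 0) ((unitsToElements T).comp f)) := by
  let θ := (unitsToElements T).comp f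
  let Ω : Type := {g : SignSpace W // Nonempty (SignClass T W g)}
  let _ : MulAction D Ω :=
    { smul x g := ⟨signDiag W (θ x : Fˣ) * g.1, g.2.map fun y => ⟨θ x * y.1, by
        rw [Subgroup.coe_mul, map_mul, y.2]⟩⟩
      one_smul g := Subtype.ext <| by
        change signDiag W (θ 1 : Fˣ) * g.1 = g.1
        rw [map_one, Subgroup.coe_one, map_one, one_mul]
      mul_smul x y g := Subtype.ext <| by
        change signDiag W (θ (x * y) : Fˣ) * g.1 = 
          signDiag W (θ x : Fˣ) * (signDiag W (θ y : Fˣ) * g.1)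
        rw [map_mul, Subgroup.coe_mul, map_mul, mul_assoc] }
  have hsmul : ∀ (x : D) (g : Ω), (x • g).1 = signDiag W (θ x : Fˣ) * g.1 := fun _ _ => rfl
  let S : Subgroup D := ((signDiag W).comp ((elementsPrimeTo T).subtype.comp θ)).ker
  let p : Symbols T W 1 → Ω := fun s => ⟨s.1, ⟨s.2 0⟩⟩
  let q : Ω → Symbols T W 1 := fun g => ⟨g.1, fun _ => g.2.some⟩
  let r : Ω → Symbols T W 0 := fun g => ⟨g.1, Fin.elim0⟩
  let π : Chains T W 1 →ₗ[ℤ] (Ω →₀ ℤ) := Finsupp.lmapDomain ℤ ℤ p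
  have hπ : ∀ s v, π (Finsupp.single s v) = Finsupp.single (p s) v := fun s v =>
    Finsupp.mapDomain_single
  have hπs : Function.Surjective π := Finsupp.mapDomain_surjective fun g => ⟨q g, rfl⟩
  have hr : Function.Injective r := fun g g' h =>
    Subtype.ext (congrArg (fun s : Symbols T W 0 => s.1) h)
  have hker : LinearMap.ker π = LinearMap.ker (boundary T W 0) := by
    have : boundary T W 0 = Finsupp.lmapDomain ℤ ℤ r ∘ₗ π := by
      refine Finsupp.lhom_ext' fun s => LinearMap.ext_ring ?_
      simp only [LinearMap.comp_apply, Finsupp.lsingle_apply]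
      rw [boundary_single, hπ, Finsupp.lmapDomain_apply, Finsupp.mapDomain_single,
        Fin.sum_univ_one, Fin.val_zero, pow_zero]
      congr 1
      exact symbols_ext T W rfl fun j => j.elim0
    rw [this, LinearMap.ker_comp_of_ker_eq_bot]
    exact LinearMap.ker_eq_bot.2 (Finsupp.mapDomain_injective hr)
  let e : (Ω →₀ ℤ) ≃ₗ[ℤ] (Chains T W 1 ⧸ LinearMap.ker (boundary T W 0)) :=
    (π.quotKerEquivOfSurjective hπs).symm ≪≫ₗ Submodule.quotEquivOfEq _ _ hker
  have he : ∀ c, e (π c) = (LinearMap.ker (boundary T W 0)).mkQ c := by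
    intro c
    have : (π.quotKerEquivOfSurjective hπs).symm (π c) = Submodule.Quotient.mk c := by
      rw [LinearEquiv.symm_apply_eq]; rfl
    rw [LinearEquiv.trans_apply, this]
    rfl
  refine .of_orbits S (fun g x => ?_) (MonoidHom.comp (sgnRep T) θ) _ e (fun x g v => ?_)
    (homologyVanishesAbove_of_signDiag_eq_one T W (f.comp S.subtype)
      (hf.comp S.subtype_injective) hW (fun x => x.2) _)
  · rw [Subtype.ext_iff, hsmul, mul_eq_right]
    rfl
  · have h1 : Finsupp.single g v = π (Finsupp.single (q g) v) := (hπ (q g) v).symm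
    have h2 : x • g = p (symbolsMul T W 1 (θ x) (q g)) := rfl
    rw [h1, he, h2, ← hπ, he]
    exact (imageRep_mkQ T W 0 (θ x) _).trans (congrArg _ (chainsRep_single T W 1 (θ x) (q g) v))

/-- Dimension shifting along `0 → C_{k+2} / ker d_{k+2} → C_{k+1} → C_{k+1} / ker d_{k+1} → 0`. -/
lemma homologyVanishesAbove_imageRep (hW : W.Nonempty) (k : ℕ) : ∀ d : ℕ,
    d + k = Module.finrank ℚ F - 1 →
      HomologyVanishesAbove d (MonoidHom.comp (imageRep T W k) ((unitsToElements T).comp f)) := by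
  induction k with
  | zero =>
    intro d hd
    rw [add_zero] at hd
    rw [hd]
    exact homologyVanishesAbove_imageRep_zero T W f hf hW
  | succ k ih =>
    intro d hd
    refine .of_shortExact_left
      (σ := MonoidHom.comp (chainsRep T W (k + 1)) ((unitsToElements T).comp f))
      (τ := MonoidHom.comp (imageRep T W k) ((unitsToElements T).comp f))
      ⟨(LinearMap.ker (boundary T W (k + 1))).liftQ (boundary T W (k + 1)) le_rfl, fun x => ?_⟩
      ⟨(LinearMap.ker (boundary T W k)).mkQ, fun x => rfl⟩ ?_
      (Submodule.mkQ_surjective _) ?_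
      ((homologyVanishesAbove_chainsRep T W f hf k).mono (Nat.zero_le d)) (ih (d + 1) (by omega))
    · apply Submodule.linearMap_qext
      exact boundary_chainsRep T W (k + 1) _
    · exact LinearMap.ker_eq_bot.1 (Submodule.ker_liftQ_eq_bot' _ _ rfl)
    · refine LinearMap.exact_iff.2 ?_
      change LinearMap.ker (LinearMap.ker (boundary T W k)).mkQ = LinearMap.range
        ((LinearMap.ker (boundary T W (k + 1))).liftQ (boundary T W (k + 1)) le_rfl)
      rw [Submodule.ker_mkQ, Submodule.range_liftQ, range_boundary_succ]

theorem homologyVanishesAbove_kRep (hW : W.Nonempty) :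
    HomologyVanishesAbove 0 (MonoidHom.comp (kRep T W) ((unitsToElements T).comp f)) :=
  homologyVanishesAbove_imageRep T W f hf hW (Module.finrank ℚ F - 1) 0 (zero_add _)

end KMod

/-! ### Twisted induction -/

section TwistedInduction

variable {G N M : Type} [CommGroup G] [CommGroup N] [AddCommGroup M] [Module ℤ M]
  (H : Subgroup G) (ι : G →* N) (ρ : Representation ℤ H M)

/-- The action of `H` on `ℤ[N]` by translations through `ι`. -/
def translationRep : Representation ℤ H (MonoidAlgebra ℤ N) where
  toFun x := LinearMap.mulLeft ℤ (MonoidAlgebra.single (ι (x : G)) (1 : ℤ))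
  map_one' := by
    rw [Subgroup.coe_one, map_one, ← MonoidAlgebra.one_def, LinearMap.mulLeft_one]
    rfl
  map_mul' x y := by
    rw [Subgroup.coe_mul, map_mul, ← mul_one (1 : ℤ), ← MonoidAlgebra.single_mul_single,
      LinearMap.mulLeft_mul, mul_one]
    rfl

/-- The representation of `H` from which `TwistedInd` is induced: `x` sends `a ⊗ b` to
`x⁻¹a ⊗ ι(x)b`. -/
def twistedRep : Representation ℤ H (M ⊗[ℤ] MonoidAlgebra ℤ N) :=
  Representation.tprod (MonoidHom.comp ρ invMonoidHom) (translationRep H ι)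

lemma twistedRep_tmul (x : H) (a : M) (b : MonoidAlgebra ℤ N) :
    twistedRep H ι ρ x (a ⊗ₜ b) =
      ρ x⁻¹ a ⊗ₜ (MonoidAlgebra.single (ι (x : G)) (1 : ℤ) * b) := rfl

/-- The relation defining `TwistedInd`, for general elements of `M ⊗ ℤ[N]`. -/
lemma mkQ_twistedRep_tmul (x : H) (m : M ⊗[ℤ] MonoidAlgebra ℤ N) (c : MonoidAlgebra ℤ G) :
    (relations H ι ρ).mkQ (twistedRep H ι ρ x m ⊗ₜ c) =
      (relations H ι ρ).mkQ (m ⊗ₜ (MonoidAlgebra.single (x : G) (1 : ℤ) * c)) := by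
  induction m using TensorProduct.induction_on with
  | zero => simp
  | add m m' h h' => rw [map_add, TensorProduct.add_tmul, TensorProduct.add_tmul, map_add, map_add,
      h, h']
  | tmul a b =>
    rw [twistedRep_tmul, ← sub_eq_zero, ← map_sub, Submodule.mkQ_apply,
      Submodule.Quotient.mk_eq_zero]
    exact Submodule.subset_span ⟨x, a, b, c, rfl⟩

theorem homologyVanishesAbove_twistedIndRep {d : ℕ}
    (h : (twistedRep H ι ρ).HomologyVanishesAbove d) :
    (twistedIndRep H ι ρ).HomologyVanishesAbove d := by
  refine .of_presentation H (twistedRep H ι ρ) (twistedIndRep H ι ρ) (relations H ι ρ).mkQ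
    (Submodule.mkQ_surjective _) (fun y m c => rfl) (mkQ_twistedRep_tmul H ι ρ) ?_ h
  rw [Submodule.ker_mkQ]
  refine Submodule.span_mono ?_
  rintro _ ⟨x, a, b, c, rfl⟩
  exact ⟨x, a ⊗ₜ b, c, rfl⟩

end TwistedInduction

section Permutation

variable {G N K A I : Type} [CommGroup G] [CommGroup N] [AddCommGroup K] [Module ℤ K]
  [AddCommGroup A] [Module ℤ A] (H : Subgroup G) (ι : G →* N) (ρ : Representation ℤ H K)
  (α : Representation ℤ H A)

/-- If `A` is a permutation module with basis `I`, then `K ⊗ A ⊗ ℤ[N]` is the module of `K`-valued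
functions on `I × N`; its homology is controlled by the stabilizers of the points of `I × N`. -/
theorem homologyVanishesAbove_twistedRep_tprod {d : ℕ} [MulAction H I]
    (a : (I →₀ ℤ) ≃ₗ[ℤ] A)
    (ha : ∀ x i, α x⁻¹ (a (Finsupp.single i 1)) = a (Finsupp.single (x • i) 1)) (S : Subgroup H)
    (hS : ∀ (x : H) (i : I), x ∈ S ↔ x • i = i ∧ ι (x : G) = 1)
    (h : HomologyVanishesAbove d (MonoidHom.comp ρ (invMonoidHom.comp S.subtype))) :
    HomologyVanishesAbove d (twistedRep H ι (Representation.tprod ρ α)) := by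
  let _ : MulAction H (I × N) :=
    { smul x ω := (x • ω.1, ι (x : G) * ω.2)
      one_smul ω := Prod.ext (one_smul H ω.1) <| by
        change ι ((1 : H) : G) * ω.2 = ω.2
        rw [Subgroup.coe_one, map_one, one_mul]
      mul_smul x y ω := Prod.ext (mul_smul x y ω.1) <| by
        change ι ((x * y : H) : G) * ω.2 = ι (x : G) * (ι (y : G) * ω.2)
        rw [Subgroup.coe_mul, map_mul, mul_assoc] }
  have hsmul : ∀ (x : H) (i : I) (n : N), x • (i, n) = (x • i, ι (x : G) * n) :=
    fun _ _ _ => rfl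
  refine .of_orbits S (fun ω x => ?_) (MonoidHom.comp ρ invMonoidHom) _ (tensorFinsuppEquiv a)
    (fun x ω v => ?_) h
  · obtain ⟨i, n⟩ := ω
    rw [hsmul, Prod.mk.injEq, mul_eq_right, ← hS]
  · obtain ⟨i, n⟩ := ω
    rw [hsmul, tensorFinsuppEquiv_single, tensorFinsuppEquiv_single, twistedRep_tmul,
      MonoidAlgebra.single_mul_single, mul_one, ← ha]
    rfl

end Permutation

/-! ### The structure of `𝒜_W` -/

section GroupRing

variable {F : Type} [Field F] [NumberField F]

/-- If `p` has infinite order in the abelian group `G` and `c ≠ 0`, an element `x` of `ℤ[G]` with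
`x (1 - c[p]) = 0` vanishes: its support would be stable under multiplication by `p`. -/
lemma eq_zero_of_mul_one_sub_single {G : Type*} [CommGroup G] {p : G}
    (hp : Function.Injective fun n : ℕ => p ^ n) {c : ℤ} (hc : c ≠ 0) {x : MonoidAlgebra ℤ G}
    (hx : x * (1 - MonoidAlgebra.single p c) = 0) : x = 0 := by
  rw [mul_sub, mul_one, sub_eq_zero] at hx
  by_contra h0
  obtain ⟨g, hg⟩ : ∃ g, x.coeff g ≠ 0 := by
    by_contra! h
    exact h0 (MonoidAlgebra.ext (Finsupp.ext h))
  have hstep : ∀ g, x.coeff g ≠ 0 → x.coeff (g * p) ≠ 0 := by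
    intro g hg
    rw [hx, MonoidAlgebra.coeff_mul_single_eq_coeff_mul g fun _ _ => mul_left_inj p]
    exact mul_ne_zero hg hc
  have hpow : ∀ n : ℕ, x.coeff (g * p ^ n) ≠ 0 := by
    intro n
    induction n with
    | zero => simpa using hg
    | succ n ih => rw [pow_succ, ← mul_assoc]; exact hstep _ ih
  refine Set.infinite_of_injective_forall_mem (s := (x.coeff.support : Set G))
    (f := fun n : ℕ => g * p ^ n) (fun m n h => hp (mul_left_cancel h))
    (fun n => by simpa using hpow n) (Finset.finite_toSet _)

lemma primeIdeal_pow_injective (p : HeightOneSpectrum (𝓞 F)) :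
    Function.Injective fun n : ℕ => primeIdeal p ^ n := by
  intro m n h
  have h' := congrArg (fun I : IdealGroup F =>
    FractionalIdeal.count F p (I : FractionalIdeal (𝓞 F)⁰ F)) h
  have hc : ∀ n : ℕ, FractionalIdeal.count F p
      ((primeIdeal p ^ n : IdealGroup F) : FractionalIdeal (𝓞 F)⁰ F) = n := fun n => by
    rw [Units.val_pow_eq_pow_val]
    exact FractionalIdeal.count_pow_self F p n
  exact Nat.cast_injective ((hc m).symm.trans (h'.trans (hc n)))

lemma eq_zero_of_mul_delta (T : Finset (Place F)) (W : Finset (HeightOneSpectrum (𝓞 F)))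
    {x : MonoidAlgebra ℤ (IdealGroup F)} (hx : x * delta T W = 0) : x = 0 := by
  have hprod : ∀ (c : HeightOneSpectrum (𝓞 F) → ℤ) (_ : ∀ p, c p ≠ 0)
      (s : Finset (HeightOneSpectrum (𝓞 F))) (x : MonoidAlgebra ℤ (IdealGroup F)),
      x * ∏ p ∈ s, (1 - MonoidAlgebra.single (primeIdeal p) (c p)) = 0 → x = 0 := by
    classical
    intro c hc s
    induction s using Finset.induction_on with
    | empty => intro x hx; simpa using hx
    | insert p s hp ih =>
      intro x hx
      rw [Finset.prod_insert hp, ← mul_assoc] at hx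
      exact eq_zero_of_mul_one_sub_single (primeIdeal_pow_injective p) (hc p) (ih _ hx)
  rw [delta, ← mul_assoc] at hx
  exact hprod (fun _ => 1) (fun _ => one_ne_zero) _ _
    (hprod (fun p => (Ideal.absNorm p.asIdeal : ℤ))
      (fun p => by simpa [Ideal.absNorm_eq_zero_iff] using p.ne_bot) _ _ hx)

variable (T : Finset (Place F)) (W : Finset (HeightOneSpectrum (𝓞 F)))

lemma linearIndependent_single_mul_delta : LinearIndependent ℤ
    fun I : idealsPrimeTo T => MonoidAlgebra.single (I : IdealGroup F) (1 : ℤ) * delta T W := by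
  have h : LinearIndependent ℤ
      fun I : IdealGroup F => (MonoidAlgebra.single I 1 : MonoidAlgebra ℤ (IdealGroup F)) :=
    (Module.Basis.ofRepr (MonoidAlgebra.coeffLinearEquiv ℤ :
      MonoidAlgebra ℤ (IdealGroup F) ≃ₗ[ℤ] _)).linearIndependent
  refine (h.comp _ Subtype.val_injective).map' (LinearMap.mulRight ℤ (delta T W)) ?_
  exact LinearMap.ker_eq_bot'.2 fun x hx => eq_zero_of_mul_delta T W hx

/-- `𝒜_W` is freely generated by `delta T W` over the group ring of the ideals coprime to `T'`. -/
def aModEquiv : (idealsPrimeTo T →₀ ℤ) ≃ₗ[ℤ] AMod T W :=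
  (linearIndependent_single_mul_delta T W).linearCombinationEquiv

lemma coe_aModEquiv_single (I : idealsPrimeTo T) :
    (aModEquiv T W (Finsupp.single I 1) : MonoidAlgebra ℤ (IdealGroup F)) =
      MonoidAlgebra.single (I : IdealGroup F) 1 * delta T W := by
  refine ((linearIndependent_single_mul_delta T W).linearCombinationEquiv_apply_coe _).trans ?_
  rw [Finsupp.linearCombination_single, one_smul]

/-- `F_(T)` acts on the group of ideals coprime to `T'` through the inverses of principal ideals.
The inverse matches the action `a ⊗ b ↦ x⁻¹a ⊗ ι(x)b` of `twistedRep`. -/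
instance idealsMulAction : MulAction (elementsPrimeTo T) (idealsPrimeTo T) where
  smul x I := ⟨toPrincipalIdeal (𝓞 F) F (x : Fˣ), x.2⟩⁻¹ * I
  one_smul I := by
    refine Subtype.ext ?_
    change (toPrincipalIdeal (𝓞 F) F 1)⁻¹ * (I : IdealGroup F) = I
    rw [map_one, inv_one, one_mul]
  mul_smul x y I := by
    refine Subtype.ext ?_
    change (toPrincipalIdeal (𝓞 F) F (x * y))⁻¹ * (I : IdealGroup F) =
      (toPrincipalIdeal (𝓞 F) F x)⁻¹ * ((toPrincipalIdeal (𝓞 F) F y)⁻¹ * I)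
    rw [map_mul, mul_inv, mul_assoc]

variable {T} in
lemma coe_smul_ideal (x : elementsPrimeTo T) (I : idealsPrimeTo T) :
    ((x • I : idealsPrimeTo T) : IdealGroup F) =
      (toPrincipalIdeal (𝓞 F) F (x : Fˣ))⁻¹ * (I : IdealGroup F) := rfl

lemma aRep_inv_single (x : elementsPrimeTo T) (I : idealsPrimeTo T) :
    aRep T W x⁻¹ (aModEquiv T W (Finsupp.single I 1)) =
      aModEquiv T W (Finsupp.single (x • I) 1) := by
  refine Subtype.ext ?_
  rw [coe_aModEquiv_single, coe_smul_ideal]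
  change MonoidAlgebra.single (toPrincipalIdeal (𝓞 F) F (x : Fˣ)⁻¹) 1 *
    (aModEquiv T W (Finsupp.single I 1) : MonoidAlgebra ℤ (IdealGroup F)) = _
  rw [coe_aModEquiv_single, ← mul_assoc, MonoidAlgebra.single_mul_single, mul_one, map_inv]

end GroupRing

/-! ### Stabilizers in `F_(T)` -/

section Units

variable {F : Type} [Field F] [NumberField F]

lemma exists_unit_of_toPrincipalIdeal_eq_one {x : Fˣ} (hx : toPrincipalIdeal (𝓞 F) F x = 1) :
    ∃ u : (𝓞 F)ˣ, Units.map (algebraMap (𝓞 F) F).toMonoidHom u = x := by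
  have hint : ∀ y : Fˣ, toPrincipalIdeal (𝓞 F) F y = 1 → ∃ a : 𝓞 F, algebraMap (𝓞 F) F a = y := by
    intro y hy
    rw [toPrincipalIdeal_eq_iff, Units.val_one] at hy
    exact (FractionalIdeal.mem_one_iff (𝓞 F)⁰).1
      (hy ▸ FractionalIdeal.mem_spanSingleton_self (𝓞 F)⁰ (y : F))
  obtain ⟨a, ha⟩ := hint x hx
  obtain ⟨b, hb⟩ := hint x⁻¹ (by rw [map_inv, hx, inv_one])
  have hab : a * b = 1 := by
    apply FaithfulSMul.algebraMap_injective (𝓞 F) F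
    rw [map_mul, ha, hb, map_one, ← Units.val_mul, mul_inv_cancel, Units.val_one]
  exact ⟨⟨a, b, hab, by rw [mul_comm, hab]⟩, Units.ext ha⟩

lemma localClass_unit (p : HeightOneSpectrum (𝓞 F)) (u : (𝓞 F)ˣ) :
    localClass p (Units.map (algebraMap (𝓞 F) F).toMonoidHom u) = 1 := by
  have hle : ∀ y : (𝓞 F)ˣ, (p.adicCompletionIntegers F).valuation
      (localUnit p (Units.map (algebraMap (𝓞 F) F).toMonoidHom y) : p.adicCompletion F) ≤ 1 := by
    intro y
    rw [ValuationSubring.valuation_le_one_iff, HeightOneSpectrum.mem_adicCompletionIntegers]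
    change Valued.v ((algebraMap (𝓞 F) F (y : 𝓞 F) : F) : p.adicCompletion F) ≤ 1
    rw [HeightOneSpectrum.valuedAdicCompletion_eq_valuation']
    exact p.valuation_le_one _
  refine (QuotientGroup.eq_one_iff _).2 ((ValuationSubring.mem_unitGroup_iff _ _).2 ?_)
  refine le_antisymm (hle u) ?_
  have h2 := hle u⁻¹
  rw [map_inv, map_inv, Units.val_inv_eq_inv_val, map_inv₀] at h2
  exact (inv_le_one₀ (zero_lt_iff.2 (by simp))).1 h2

/-- In `F_(T)`, the stabilizer of each point of `𝖨_(T) × N^S` is the unit group. -/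
lemma mem_range_unitsToElements_iff (S T : Finset (Place F)) (x : elementsPrimeTo T) :
    x ∈ (unitsToElements (F := F) T).range ↔
      toPrincipalIdeal (𝓞 F) F (x : Fˣ) = 1 ∧ diagAway S (x : Fˣ) = 1 := by
  constructor
  · rintro ⟨u, rfl⟩
    refine ⟨?_, Subtype.ext <| funext fun p => localClass_unit p.1 u⟩
    rw [toPrincipalIdeal_eq_iff, Units.val_one]
    change FractionalIdeal.spanSingleton (𝓞 F)⁰ (algebraMap (𝓞 F) F (u : 𝓞 F)) = 1
    rw [← FractionalIdeal.coeIdeal_span_singleton, Ideal.span_singleton_eq_top.2 u.isUnit,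
      FractionalIdeal.coeIdeal_top]
  · rintro ⟨h, -⟩
    obtain ⟨u, hu⟩ := exists_unit_of_toPrincipalIdeal_eq_one h
    exact ⟨u, Subtype.ext hu⟩

end Units

/-! ### The homology of `B(W)` -/

section B

variable {F : Type} [Field F] [NumberField F] [IsTotallyReal F] (S T V W : Finset (Place F))

omit [IsTotallyReal F] in
variable {S V} in
open Classical in
lemma toLeft_barSet_nonempty {v : InfinitePlace F} (hS : Sum.inl v ∈ S) (hV : Sum.inl v ∉ V) :
    (barSet S V W).toLeft.Nonempty :=
  ⟨v, Finset.mem_toLeft.2 (Finset.mem_union_right _ (Finset.mem_sdiff.2 ⟨hS, hV⟩))⟩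

theorem homologyVanishesAbove_bRep (hW : (barSet S V W).toLeft.Nonempty) :
    HomologyVanishesAbove 0 (twistedIndRep (elementsPrimeTo T) (diagAway S) (mRep S T V W)) := by
  refine homologyVanishesAbove_twistedIndRep _ _ _ ?_
  refine homologyVanishesAbove_twistedRep_tprod _ _ _ _ (aModEquiv T _) (aRep_inv_single T _)
    (unitsToElements T).range (fun x I => ?_) ?_
  · rw [mem_range_unitsToElements_iff S, Subtype.ext_iff, coe_smul_ideal, mul_eq_right, inv_eq_one]
  · let e := MonoidHom.ofInjective (unitsToElements_injective (F := F) T)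
    have h := homologyVanishesAbove_kRep T _ (e.symm.toMonoidHom.comp invMonoidHom)
      (e.symm.injective.comp inv_injective) hW
    convert h using 2
    ext x : 1
    exact congrArg Subtype.val (e.apply_symm_apply x⁻¹).symm

end B

end ShintaniDatum

end

theorem mainTheorem5 (F : Type) [Field F] [NumberField F] [NumberField.IsTotallyReal F]
    (S T V : Finset (ShintaniDatum.Place F))
    (hS : ∀ v : NumberField.InfinitePlace F, Sum.inl v ∈ S)
    (hST : Disjoint S T) (hV : V ⊂ S) (hC1 : ShintaniDatum.ConditionC1 S T V) :
    (∀ W : Finset (NumberField.InfinitePlace F), W.Nonempty → ∀ i : ℕ, 0 < i →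
      CategoryTheory.Limits.IsZero (groupHomology (ShintaniDatum.kUnitsRep T W) i)) ∧
    (∀ W : Finset (ShintaniDatum.Place F), W ⊆ V → ∀ i : ℕ, 0 < i →
      CategoryTheory.Limits.IsZero (groupHomology (ShintaniDatum.bRep S T V W) i)) := by
  refine ⟨fun W hW => ShintaniDatum.homologyVanishesAbove_kRep T W (MonoidHom.id _)
    Function.injective_id hW, fun W _ => ShintaniDatum.homologyVanishesAbove_bRep S T V W ?_⟩
  obtain ⟨v, hv⟩ := hC1.exists_infinite_notMem
  exact ShintaniDatum.toLeft_barSet_nonempty W (hS v) hv
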